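/- **Setting.** The network is a finite connected graph $G=(V,E)$ with maximal degree $\Delta$, diameter $D$, and neighbour sets $N_p$. In the local shared memory model each processor $p$ reads its own and its neighbours' variables and writes its own. In each step a distributed, weakly fair daemon chooses some enabled processors, which act simultaneously. An execution starts from an arbitrary configuration (variables with arbitrary values in their domains). A *round* starting at a configuration $\gamma$ is the shortest portion of the execution after $\gamma$ in which every processor enabled in $\gamma$ either acts or is neutralized (becomes disabled without acting). A silent self-stabilizing algorithm $\mathcal A$ computes routing tables: $nextHop_p(d)\in N_p$ for $p\ne d$ (by convention $nextHop_d(d)=d$). Its stabilization time $R_{\mathcal A}$ is the least $R$ such that, in every execution of $\mathcal A$ alone, after $R$ rounds no action of $\mathcal A$ is enabled and all tables are correct, i.e. $dist(nextHop_p(d),d)=dist(p,d)-1$ for all $p\neq d$. **Protocol $\mathcal{SSMFP}_1$.** Each $p$ has, for every destination $d$, two buffers $bufR_p(d)$, $bufE_p(d)$. Each is empty ($\varepsilon$) or contains a triple $(m,q,c)$ with useful information $m$, last processor $q\in N_p\cup\{p\}$, and color $c\in\{0,\dots,\Delta\}$. The higher layer of $p$ may set the Boolean $request_p$ to true when it is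 false, with a waiting message $nextMessage_p$ of destination $nextDestination_p$; both stay unchanged while $request_p$ is true. $choice_p(d)$ is the first element $s$ of a queue (an ordering of $N_p\cup\{p\}$, initially arbitrary) such that either $s\in N_p$, $bufE_s(d)\ne\varepsilon$ and $nextHop_s(d)=p$, or $s=p$, $request_p$ is true and $nextDestination_p=d$. A processor served by $R_1$ or $R_3$ moves to the end of the queue. The rules of $p$ for $d$ are ($*$ stands for an arbitrary value): - $R_1$: if $request_p$, $nextDestination_p=d$, $bufR_p(d)=\varepsilon$ and $choice_p(d)=p$, then $bufR_p(d):=(nextMessage_p,p,0)$ and $request_p:=false$ (generation). - $R_2$: if $bufE_p(d)=\varepsilon$, $bufR_p(d)=(m,q,c)$, and $q=p$ or $bufE_q(d)\ne(m,*,c)$, then $bufE_p(d):=(m,p,c')$ and $bufR_p(d):=\varepsilon$, where $c'\in\{0,\dots,\Delta\}$ is any color not carried by a message in a $bufR_r(d)$, $r\in N_p$. - $R_3$: if $bufR_p(d)=\varepsilon$, $choice_p(d)=s\neq p$ and $bufE_s(d)=(m,q,c)$, then $bufR_p(d):=(m,s,c)$. - $R_4$: if $p\ne d$, $bufE_p(d)=(m,q,c)$,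 $bufR_{nextHop_p(d)}(d)=(m,p,c)$ and $bufR_r(d)\neq(m,p,c)$ for all $r\in N_p\setminus\{nextHop_p(d)\}$, then $bufE_p(d):=\varepsilon$. - $R_5$: if $bufR_p(d)=(m,q,c)$, $q\neq p$, $bufE_q(d)=(m,*,c)$ and $nextHop_q(d)\ne p$, then $bufR_p(d):=\varepsilon$. - $R_6$: if $p=d$ and $bufE_p(p)=(m,q,c)$, then $m$ is delivered to $p$ and $bufE_p(p):=\varepsilon$. $\mathcal A$ runs simultaneously and has priority. A chosen processor with an enabled action of $\mathcal A$ executes an action of $\mathcal A$. Otherwise, simultaneously for every destination for which it has enabled rules, it executes one of them. Messages generated at different times are different, even if their useful information is equal; a message is followed through the copies made by $R_2$ and $R_3$. **Proposition.** There is an absolute constant $C$ such that, for every such network, every such $\mathcal A$ with finite stabilization time $R_{\mathcal A}$, every execution of $\mathcal{SSMFP}_1$ together with $\mathcal A$, and every message generated in it by $R_1$ with some destination $d$, this message is delivered to $d$ within the first $C\cdot\max(R_{\mathcal A},\Delta^{D})$ rounds counted from the configuration that follows its generation. -/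

import Mathlib

universe u v w

namespace SSMFP

/-! ### Rounds

An execution is observed through two predicates: `en i p` (processor `p` is enabled in the `i`-th
configuration) and `act i p` (processor `p` executes an action in the step from the `i`-th to the
`(i+1)`-th configuration). -/

section Rounds

variable {V : Type u}

/-- `p` is neutralized in step `k`: enabled before, not enabled after, and it did not act. -/
def Neutralized (en act : ℕ → V → Prop) (k : ℕ) (p : V) : Prop :=
  en k p ∧ ¬ en (k + 1) p ∧ ¬ act k p

/-- The nonempty portion from configuration `i` to configuration `j` contains an action or the
neutralization of every processor that is enabled in configuration `i`. -/
def CoversRound (en act : ℕ → V → Prop) (i j : ℕ) : Prop :=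
  i < j ∧ ∀ p, en i p → ∃ k, i ≤ k ∧ k < j ∧ (act k p ∨ Neutralized en act k p)

/-- The index at which the round that starts at configuration `i` ends (shortest such portion). -/
noncomputable def nextRound (en act : ℕ → V → Prop) (i : ℕ) : ℕ :=
  sInf {j | CoversRound en act i j}

/-- The index of the configuration at the end of the first `K` rounds counted from
configuration `i`. -/
noncomputable def roundEnd (en act : ℕ → V → Prop) (i K : ℕ) : ℕ :=
  (nextRound en act)^[K] i

/-- The daemon is weakly fair: a processor that is enabled from some point on is chosen. -/
def WeaklyFair (en act : ℕ → V → Prop) : Prop :=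
  ∀ p i, (∀ j, i ≤ j → en j p) → ∃ j, i ≤ j ∧ act j p

/-- Under a weakly fair daemon every round is finite, so `nextRound` is a genuine minimum. -/
theorem exists_coversRound [Finite V] {en act : ℕ → V → Prop} (h : WeaklyFair en act) (i : ℕ) :
    {j | CoversRound en act i j}.Nonempty := by
  classical
  have key : ∀ p, ∃ k, en i p → i ≤ k ∧ (act k p ∨ Neutralized en act k p) := by
    intro p
    by_cases hall : ∀ j, i ≤ j → en j p
    · obtain ⟨j, hj, ha⟩ := h p i hall
      exact ⟨j, fun _ => ⟨hj, Or.inl ha⟩⟩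
    · by_cases hen : en i p
      · have hex : ∃ n, ¬ en (i + n) p := by
          by_contra hcon
          refine hall fun j hj => ?_
          by_contra hne
          exact hcon ⟨j - i, by rwa [Nat.add_sub_cancel' hj]⟩
        have hmin := Nat.find_spec hex
        have hpos : Nat.find hex ≠ 0 := by
          intro h0
          rw [h0] at hmin
          exact hmin hen
        obtain ⟨n, hn⟩ := Nat.exists_eq_succ_of_ne_zero hpos
        have hlt : en (i + n) p := by
          have := Nat.find_min hex (m := n) (by omega)
          exact not_not.mp this
        rw [hn] at hmin
        refine ⟨i + n, fun _ => ⟨by omega, ?_⟩⟩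
        by_cases ha : act (i + n) p
        · exact Or.inl ha
        · exact Or.inr ⟨hlt, hmin, ha⟩
      · exact ⟨0, fun hh => absurd hh hen⟩
  choose k hk using key
  obtain ⟨B, hB⟩ := (Set.finite_range k).bddAbove
  refine ⟨max i B + 1, by omega, fun p hp => ⟨k p, (hk p hp).1, ?_, (hk p hp).2⟩⟩
  have : k p ≤ B := hB ⟨p, rfl⟩
  omega

end Rounds

/-! ### The routing algorithm -/

/-- A protocol of the local shared memory model that computes routing tables. `moves p γ` is the
set of local states that `p` can reach by one of its enabled actions in configuration `γ`;
it depends only on the variables of `p` and of its neighbours. `nextHop p s d` is the routing table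
entry for destination `d` of processor `p` in local state `s`: a neighbour of `p` if `p ≠ d`
(possibly a wrong one). A processor never has to forward its own messages, and the unused entry
for `d` at `d` is `d` by convention. -/
structure RoutingAlgorithm {V : Type u} (G : SimpleGraph V) (σ : Type w) where
  moves : V → (V → σ) → Set σ
  moves_congr : ∀ p γ γ', γ p = γ' p → (∀ q, G.Adj p q → γ q = γ' q) → moves p γ = moves p γ'
  nextHop : V → σ → V → V
  nextHop_adj : ∀ p s d, p ≠ d → G.Adj p (nextHop p s d)
  nextHop_self : ∀ s d, nextHop d s d = d

namespace RoutingAlgorithm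

variable {V : Type u} {G : SimpleGraph V} {σ : Type w} (A : RoutingAlgorithm G σ)

/-- Some action of `A` is enabled at `p`. -/
def Enabled (γ : V → σ) (p : V) : Prop := (A.moves p γ).Nonempty

/-- All routing tables are correct: they induce paths with a minimal number of edges. -/
def Correct (γ : V → σ) : Prop :=
  ∀ p d, p ≠ d → G.dist (A.nextHop p (γ p) d) d + 1 = G.dist p d

/-- `(conf, act)` is an execution of `A` alone under a distributed weakly fair daemon, from an
arbitrary configuration. Steps in which no processor acts are allowed: they change nothing, they do
not affect rounds, weak fairness rules out that the execution idles forever in a nonterminal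
configuration, and a finite maximal execution idles forever in its terminal configuration. -/
structure IsExecution (conf : ℕ → V → σ) (act : ℕ → V → Prop) : Prop where
  step : ∀ i p, act i p → conf (i + 1) p ∈ A.moves p (conf i)
  idle : ∀ i p, ¬ act i p → conf (i + 1) p = conf i p
  fair : WeaklyFair (fun i p => A.Enabled (conf i) p) act

/-- In every execution, after `R` rounds the routing tables are correct and no action of `A` is
enabled any more (`A` is silent). -/
def StabilizesWithin (R : ℕ) : Prop :=
  ∀ conf act, A.IsExecution conf act →
    A.Correct (conf (roundEnd (fun i p => A.Enabled (conf i) p) act 0 R)) ∧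
    ∀ p, ¬ A.Enabled (conf (roundEnd (fun i p => A.Enabled (conf i) p) act 0 R)) p

/-- `R` is the stabilization time of the silent self-stabilizing algorithm `A`: the worst-case
number of rounds that it needs. -/
def IsStabilizationTime (R : ℕ) : Prop := IsLeast {R | A.StabilizesWithin R} R

end RoutingAlgorithm

/-! ### The message forwarding protocol -/

/-- A message as stored in a buffer: useful information, last processor crossed, and a color in
`{0, …, Δ}`. -/
structure Msg (V : Type u) (M : Type v) (Δ : ℕ) where
  info : M
  last : V
  color : Fin (Δ + 1)

/-- A configuration of the whole system. `route` holds the variables of the routing algorithm.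
`bufR p d`, `bufE p d` are the reception and emission buffers of `p` for destination `d` (`none` if
empty). `request p = none` means that the Boolean `request_p` is false, `request p = some (m, d)`
means that it is true, the waiting message has useful information `m` and destination `d`.
`queue p d` is the queue of processors that implements `choice_p(d)`. -/
structure Config (V : Type u) (M : Type v) (σ : Type w) (Δ : ℕ) where
  route : V → σ
  bufR : V → V → Option (Msg V M Δ)
  bufE : V → V → Option (Msg V M Δ)
  request : V → Option (M × V)
  queue : V → V → List V

/-- Names of the six rules: generation, internal forwarding, forwarding, erasing after forwarding,
erasing after duplication, consumption. -/
inductive Rule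
  | R1 | R2 | R3 | R4 | R5 | R6

section Protocol

variable {V : Type u} [Fintype V] [DecidableEq V] {G : SimpleGraph V} [DecidableRel G.Adj]
  {M : Type v} {σ : Type w} (A : RoutingAlgorithm G σ)

/-- The variables of `γ` have values in their domains: a message in a buffer of `p` was last at `p`
or at a neighbour of `p`, and the queue of `p` lists `p` and its neighbours, each once. -/
def WellTyped (G : SimpleGraph V) [DecidableRel G.Adj] (γ : Config V M σ G.maxDegree) : Prop :=
  (∀ p d x, γ.bufR p d = some x → x.last = p ∨ G.Adj p x.last) ∧
  (∀ p d x, γ.bufE p d = some x → x.last = p ∨ G.Adj p x.last) ∧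
  (∀ p d, (γ.queue p d).Nodup ∧ ∀ q, q ∈ γ.queue p d ↔ (q = p ∨ G.Adj p q))

/-- `nextHop_p(d)` in configuration `γ`. -/
def hop (γ : Config V M σ G.maxDegree) (p d : V) : V := A.nextHop p (γ.route p) d

/-- Processor `s` can forward a message into `bufR_p(d)`, or `s = p` can generate one there. -/
def Candidate (γ : Config V M σ G.maxDegree) (p d s : V) : Prop :=
  (G.Adj p s ∧ γ.bufE s d ≠ none ∧ hop A γ s d = p) ∨ (s = p ∧ ∃ m, γ.request p = some (m, d))

open Classical in
/-- `choice_p(d)`: the first candidate in the queue, if there is one. -/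
noncomputable def choice (γ : Config V M σ G.maxDegree) (p d : V) : Option V :=
  (γ.queue p d).find? (fun s => decide (Candidate A γ p d s))

/-- The buffer content `b` has the form `(m, q', c)` for some `q'`, where `x = (m, q, c)`. -/
def SameInfoColor {V : Type u} {M : Type v} {Δ : ℕ} (b : Option (Msg V M Δ)) (x : Msg V M Δ) :
    Prop :=
  ∃ y, b = some y ∧ y.info = x.info ∧ y.color = x.color

/-- The guards of the rules of `p` for destination `d`. -/
def Guard (γ : Config V M σ G.maxDegree) (p d : V) : Rule → Prop
  | .R1 => (∃ m, γ.request p = some (m, d)) ∧ γ.bufR p d = none ∧ choice A γ p d = some p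
  | .R2 => γ.bufE p d = none ∧
      ∃ x, γ.bufR p d = some x ∧ (x.last = p ∨ ¬ SameInfoColor (γ.bufE x.last d) x)
  | .R3 => γ.bufR p d = none ∧
      ∃ s, choice A γ p d = some s ∧ s ≠ p ∧ γ.bufE s d ≠ none
  | .R4 => ∃ x, γ.bufE p d = some x ∧ p ≠ d ∧
      γ.bufR (hop A γ p d) d = some ⟨x.info, p, x.color⟩ ∧
      ∀ r, G.Adj p r → r ≠ hop A γ p d → γ.bufR r d ≠ some ⟨x.info, p, x.color⟩
  | .R5 => ∃ x, γ.bufR p d = some x ∧ x.last ≠ p ∧ SameInfoColor (γ.bufE x.last d) x ∧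
      hop A γ x.last d ≠ p
  | .R6 => p = d ∧ γ.bufE p d ≠ none

/-- The statements of the rules: `Effect A γ p d r R' E' Q'` says that `R'`, `E'`, `Q'` are possible
new contents of `bufR_p(d)`, of `bufE_p(d)` and of the queue after `p` executed rule `r` for
destination `d` in `γ` (`r = none`: no rule). In `R2` the new color is any color not carried by a
message in a reception buffer of a neighbour. The processor served by `R1` or `R3` goes to the end
of the queue. -/
def Effect (γ : Config V M σ G.maxDegree) (p d : V) (r : Option Rule)
    (R' E' : Option (Msg V M G.maxDegree)) (Q' : List V) : Prop :=
  match r with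
  | none => R' = γ.bufR p d ∧ E' = γ.bufE p d ∧ Q' = γ.queue p d
  | some .R1 => ∃ m, γ.request p = some (m, d) ∧ R' = some ⟨m, p, 0⟩ ∧ E' = γ.bufE p d ∧
      Q' = (γ.queue p d).erase p ++ [p]
  | some .R2 => ∃ x c, γ.bufR p d = some x ∧
      (∀ q, G.Adj p q → ∀ y, γ.bufR q d = some y → y.color ≠ c) ∧
      R' = none ∧ E' = some ⟨x.info, p, c⟩ ∧ Q' = γ.queue p d
  | some .R3 => ∃ s x, choice A γ p d = some s ∧ γ.bufE s d = some x ∧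
      R' = some ⟨x.info, s, x.color⟩ ∧ E' = γ.bufE p d ∧ Q' = (γ.queue p d).erase s ++ [s]
  | some .R4 => R' = γ.bufR p d ∧ E' = none ∧ Q' = γ.queue p d
  | some .R5 => R' = none ∧ E' = γ.bufE p d ∧ Q' = γ.queue p d
  | some .R6 => R' = γ.bufR p d ∧ E' = none ∧ Q' = γ.queue p d

/-- Processor `p` is enabled: for the routing algorithm, or for the forwarding protocol. -/
def Enabled (γ : Config V M σ G.maxDegree) (p : V) : Prop :=
  A.Enabled γ.route p ∨ ∃ d r, Guard A γ p d r

/-- One step `γ → γ'`, in which the processors of `chosen` act and `rule p d` is the rule that `p`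
executes for destination `d`. A chosen processor executes an action of the routing algorithm if one
is enabled (priority); otherwise it executes, for all destinations simultaneously, one enabled rule
for each destination that has one. In addition the higher layer may raise a request at
every processor whose request is not pending; a pending request is kept until `R1` resets it. -/
structure Step (γ γ' : Config V M σ G.maxDegree) (chosen : V → Prop)
    (rule : V → V → Option Rule) : Prop where
  enabled : ∀ p, chosen p → Enabled A γ p
  idle : ∀ p, ¬ chosen p → γ'.route p = γ.route p ∧ ∀ d, rule p d = none
  routing : ∀ p, chosen p → A.Enabled γ.route p →
    γ'.route p ∈ A.moves p γ.route ∧ ∀ d, rule p d = none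
  forwarding : ∀ p, chosen p → ¬ A.Enabled γ.route p →
    γ'.route p = γ.route p ∧
      ∀ d, (∃ r, rule p d = some r ∧ Guard A γ p d r) ∨
        (rule p d = none ∧ ∀ r, ¬ Guard A γ p d r)
  effect : ∀ p d, Effect A γ p d (rule p d) (γ'.bufR p d) (γ'.bufE p d) (γ'.queue p d)
  request_reset : ∀ p d, rule p d = some .R1 → γ'.request p = none
  request_kept : ∀ p, (∀ d, rule p d ≠ some .R1) → ∀ x, γ.request p = some x →
    γ'.request p = some x

/-- An execution of the forwarding protocol together with the routing algorithm `A`, from an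
arbitrary configuration, under a distributed weakly fair daemon (idle steps are as for `A`). -/
structure Execution (M : Type v) where
  conf : ℕ → Config V M σ G.maxDegree
  chosen : ℕ → V → Prop
  rule : ℕ → V → V → Option Rule
  init : WellTyped G (conf 0)
  step : ∀ i, Step A (conf i) (conf (i + 1)) (chosen i) (rule i)
  fair : WeaklyFair (fun i p => Enabled A (conf i) p) chosen

variable {A}

/-- End of the first `K` rounds counted from the `i`-th configuration. -/
noncomputable def Execution.roundEnd (e : Execution A M) (i K : ℕ) : ℕ :=
  SSMFP.roundEnd (fun i p => Enabled A (e.conf i) p) e.chosen i K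

/-- In step `t`, processor `p` generates a message of destination `d`. -/
def Execution.Generates (e : Execution A M) (t : ℕ) (p d : V) : Prop :=
  e.rule t p d = some .R1

/-- A buffer for a given destination: the reception or the emission buffer of a processor. -/
inductive Buffer (V : Type u)
  | R (p : V)
  | E (p : V)

/-- `e.Carries t p d i b`: in configuration `i`, buffer `b` for destination `d` contains (a copy of)
the very message that `p` generated in step `t`. Messages with the same useful information that are
generated at different times are thus distinguished. -/
inductive Execution.Carries (e : Execution A M) (t : ℕ) (p d : V) : ℕ → Buffer V → Prop
  | gen : e.rule t p d = some .R1 → Carries e t p d (t + 1) (.R p)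
  | keepR {i : ℕ} {q : V} : Carries e t p d i (.R q) → e.rule i q d ≠ some .R2 →
      e.rule i q d ≠ some .R5 → Carries e t p d (i + 1) (.R q)
  | keepE {i : ℕ} {q : V} : Carries e t p d i (.E q) → e.rule i q d ≠ some .R4 →
      e.rule i q d ≠ some .R6 → Carries e t p d (i + 1) (.E q)
  | move {i : ℕ} {q : V} : Carries e t p d i (.R q) → e.rule i q d = some .R2 →
      Carries e t p d (i + 1) (.E q)
  | copy {i : ℕ} {q s : V} : Carries e t p d i (.E s) → e.rule i q d = some .R3 →
      choice A (e.conf i) q d = some s → Carries e t p d (i + 1) (.R q)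

/-- In step `t'`, the message of destination `d` that `p` generated in step `t` is delivered
to `d`. -/
def Execution.Delivers (e : Execution A M) (t : ℕ) (p d : V) (t' : ℕ) : Prop :=
  e.Carries t p d t' (.E d) ∧ e.rule t' d d = some .R6

end Protocol

end SSMFP

/-! The argument separates safety, which holds even with wrong tables, from speed, which needs
correct ones.

Safety. The color picked by `R2` differs from all those in the neighbouring reception buffers. Hence
a message entering an emission buffer is not confused with an older look-alike, and a message
released from its source never becomes blocked again, nor erasable by `R5`. Since `R4` waits for a
copy at the next hop, one genuine copy can always be followed (`exists_buffer_of_generates`).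

Stabilization. Priority lets `A` run as if it were alone, and its rounds end no later than those of
the composition. So the tables are correct and frozen after at most `RA` rounds (`exists_stable`).

Speed. Let E(δ) bound the rounds until a full emission buffer at distance δ from `d` is emptied. At
`d` itself, `R6` gives E(0) = 3. For `p` at distance δ + 1, the next hop `n` is at distance δ; its
reception buffer is emptied within E(δ) + 6 rounds and refilled within 2 more, each refill sending
the served processor to the end of the queue. So `p` waits for at most as many refills as `n` has
processors to serve, and 5 more rounds erase its copy. The queue of `n` has at most Δ + 1 entries,
but if `n ≠ d` the next hop of `n` never forwards back to `n`, which leaves Δ. This saving yields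
order Δ^δ rather than (Δ + 1)^δ (`Stable.countP_le`, `Stable.emptiesE`). Summing 2E(δ) + 6 along a
shortest path gives a geometric sum if Δ ≥ 2; if Δ ≤ 1, no distance exceeds 1.

The constant waiting times come from `exists_event_of_rank`: a chosen processor may execute any
enabled rule for `d`, and a small rank bounds how often it can avoid the desired one. -/

namespace SSMFP

/-! ### Comparing rounds and bounding waiting times -/

section RoundLemmas

variable {V : Type u} {en act : ℕ → V → Prop}

/-- A processor enabled at `i` that neither acts nor is neutralized before `i'` is still enabled at
`i'`, so the later portion takes care of it. This makes `nextRound` monotone, so that waiting times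
measured from different configurations can be added. -/
theorem CoversRound.anti_left {i i' j : ℕ} (hi : i ≤ i') (h : CoversRound en act i' j) :
    CoversRound en act i j := by
  refine ⟨hi.trans_lt h.1, fun p hp => ?_⟩
  by_contra hcon
  have hen : ∀ k, i ≤ k → k ≤ i' → en k p := by
    intro k hk
    induction k, hk using Nat.le_induction with
    | base => exact fun _ => hp
    | succ k hk ih =>
      intro hk'
      by_contra hne
      exact hcon ⟨k, hk, by have := h.1; omega, (em (act k p)).imp_right
        fun ha => ⟨ih (by omega), hne, ha⟩⟩
  obtain ⟨k, hk, hk', ha⟩ := h.2 p (hen i' hi le_rfl)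
  exact hcon ⟨k, hi.trans hk, hk', ha⟩

theorem roundEnd_add (i K L : ℕ) :
    roundEnd en act i (K + L) = roundEnd en act (roundEnd en act i K) L := by
  rw [roundEnd, Nat.add_comm, Function.iterate_add_apply]; rfl

theorem roundEnd_one (i : ℕ) : roundEnd en act i 1 = nextRound en act i := rfl

/-- The first index of an interval at which `P` holds. -/
theorem exists_first {P : ℕ → Prop} {i N : ℕ} (h : ∃ j, i ≤ j ∧ j < N ∧ P j) :
    ∃ j, i ≤ j ∧ j < N ∧ P j ∧ ∀ k, i ≤ k → k < j → ¬ P k := by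
  classical
  have hj := Nat.find_spec h
  exact ⟨Nat.find h, hj.1, hj.2.1, hj.2.2,
    fun k hk hkj hP => Nat.find_min h hkj ⟨hk, hkj.trans hj.2.1, hP⟩⟩

/-- A property that persists unless `G` happens is kept along an interval without `G`. -/
theorem persists {P G : ℕ → Prop} (hstep : ∀ k, P k → ¬ G k → P (k + 1)) {i j : ℕ}
    (hG : ∀ k, i ≤ k → k < j → ¬ G k) (hP : P i) (hij : i ≤ j) : P j := by
  induction j, hij using Nat.le_induction with
  | base => exact hP
  | succ j hj ih => exact hstep j (ih fun k h1 h2 => hG k h1 (by omega)) (hG j hj (by omega))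

variable [Finite V] (h : WeaklyFair en act)
include h

theorem nextRound_covers (i : ℕ) : CoversRound en act i (nextRound en act i) :=
  Nat.sInf_mem (exists_coversRound h i)

theorem nextRound_mono : Monotone (nextRound en act) := fun _ j hij =>
  Nat.sInf_le ((nextRound_covers h j).anti_left hij)

theorem roundEnd_mono_left (K : ℕ) {i j : ℕ} (hij : i ≤ j) :
    roundEnd en act i K ≤ roundEnd en act j K :=
  (nextRound_mono h).iterate K hij

theorem le_roundEnd (i K : ℕ) : i ≤ roundEnd en act i K :=
  Function.id_le_iterate_of_id_le (fun j => (nextRound_covers h j).1.le) K i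

theorem roundEnd_mono_right (i : ℕ) {K L : ℕ} (hKL : K ≤ L) :
    roundEnd en act i K ≤ roundEnd en act i L := by
  obtain ⟨n, rfl⟩ := Nat.exists_eq_add_of_le hKL
  rw [roundEnd_add]
  exact le_roundEnd h _ _

theorem roundEnd_trans {i j K L : ℕ} (hij : j ≤ roundEnd en act i K) :
    roundEnd en act j L ≤ roundEnd en act i (K + L) := by
  rw [roundEnd_add]
  exact roundEnd_mono_left h L hij

theorem exists_act_of_enabled {p : V} {i : ℕ}
    (hen : ∀ k, i ≤ k → k ≤ nextRound en act i → en k p) :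
    ∃ k, i ≤ k ∧ k < nextRound en act i ∧ act k p := by
  have hc := nextRound_covers h i
  obtain ⟨k, hk, hk', ha | ha⟩ := hc.2 p (hen i le_rfl hc.1.le)
  · exact ⟨k, hk, hk', ha⟩
  · exact absurd (hen (k + 1) (by omega) (by omega)) ha.2.1

/-- If `p` stays enabled while `P` holds, and every action of `p` decreases a rank that never
increases, then the event `G`, which alone can end `P`, happens within one round more than the
rank. -/
theorem exists_event_of_rank {p : V} {P G : ℕ → Prop} {f : ℕ → ℕ} (hen : ∀ k, P k → en k p)
    (hstep : ∀ k, P k → ¬ G k → P (k + 1) ∧ f (k + 1) ≤ f k ∧ (act k p → f (k + 1) < f k))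
    (n : ℕ) : ∀ i, P i → f i ≤ n →
      ∃ j, i ≤ j ∧ j < roundEnd en act i (n + 1) ∧ G j := by
  induction n with
  | zero =>
    intro i hP hf
    by_contra! hG
    rw [zero_add, roundEnd_one] at hG
    have hPk : ∀ k, i ≤ k → k ≤ nextRound en act i → P k ∧ f k ≤ 0 := fun k hk hk' =>
      persists (P := fun k => P k ∧ f k ≤ 0) (G := G)
        (fun m hm hg => ⟨(hstep m hm.1 hg).1, (hstep m hm.1 hg).2.1.trans hm.2⟩)
        (fun m h1 h2 => hG m h1 (by omega)) ⟨hP, hf⟩ hk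
    -- A processor enabled throughout a round is not neutralized, so it acts; at rank zero there is
    -- nothing left to decrease.
    obtain ⟨k, hk, hk', ha⟩ := exists_act_of_enabled h
      (fun k h1 h2 => hen k (hPk k h1 h2).1)
    have := (hstep k (hPk k hk hk'.le).1 (hG k hk hk')).2.2 ha
    have := (hPk k hk hk'.le).2
    omega
  | succ n ih =>
    intro i hP hf
    by_contra! hG
    have hle : nextRound en act i ≤ roundEnd en act i (n + 1 + 1) := by
      rw [← roundEnd_one]; exact roundEnd_mono_right h i (by omega)
    have hPk : ∀ k, i ≤ k → k ≤ nextRound en act i → P k ∧ f k ≤ n + 1 := fun k hk hk' =>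
      persists (P := fun k => P k ∧ f k ≤ n + 1) (G := G)
        (fun m hm hg => ⟨(hstep m hm.1 hg).1, (hstep m hm.1 hg).2.1.trans hm.2⟩)
        (fun m h1 h2 => hG m h1 (by omega)) ⟨hP, hf⟩ hk
    obtain ⟨k, hk, hk', ha⟩ := exists_act_of_enabled h
      (fun k h1 h2 => hen k (hPk k h1 h2).1)
    have h1 := hstep k (hPk k hk hk'.le).1 (hG k hk (by omega))
    have h2 := h1.2.2 ha
    have h3 := (hPk k hk hk'.le).2
    obtain ⟨j, hj, hj', hGj⟩ := ih (k + 1) h1.1 (by omega)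
    refine hG j (by omega) (hj'.trans_le ?_) hGj
    rw [Nat.add_comm (n + 1) 1]
    exact roundEnd_trans h hk'

end RoundLemmas

/-! ### Effect of one step on the buffers and queues -/

section Steps

variable {V : Type u} [Fintype V] [DecidableEq V] {G : SimpleGraph V} [DecidableRel G.Adj]
  {M : Type v} {σ : Type w} {A : RoutingAlgorithm G σ}

omit [DecidableEq V] in
theorem choice_candidate {γ : Config V M σ G.maxDegree} {p d s : V}
    (h : choice A γ p d = some s) : Candidate A γ p d s := by
  simpa using List.find?_some h

namespace Execution

variable (e : Execution A M) {i : ℕ} {p d : V}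

theorem rule_spec {r : Rule} (h : e.rule i p d = some r) :
    Guard A (e.conf i) p d r ∧ e.chosen i p ∧ ¬ A.Enabled (e.conf i).route p := by
  have hs := e.step i
  by_cases hc : e.chosen i p
  · by_cases ha : A.Enabled (e.conf i).route p
    · simp [(hs.routing p hc ha).2 d] at h
    · rcases (hs.forwarding p hc ha).2 d with ⟨r', h1, h2⟩ | ⟨h1, -⟩
      · rw [h] at h1
        cases h1
        exact ⟨h2, hc, ha⟩
      · simp [h] at h1
  · simp [(hs.idle p hc).2 d] at h

theorem guard_of_rule {r : Rule} (h : e.rule i p d = some r) : Guard A (e.conf i) p d r :=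
  (e.rule_spec h).1

theorem effect_R1 (h : e.rule i p d = some .R1) : ∃ m,
    (e.conf (i + 1)).bufR p d = some ⟨m, p, 0⟩ ∧
    (e.conf (i + 1)).bufE p d = (e.conf i).bufE p d ∧
    (e.conf (i + 1)).queue p d = ((e.conf i).queue p d).erase p ++ [p] := by
  have := (e.step i).effect p d
  rw [h] at this
  obtain ⟨m, -, h1⟩ := this
  exact ⟨m, h1⟩

theorem effect_R2 (h : e.rule i p d = some .R2) : ∃ x c, (e.conf i).bufR p d = some x ∧
    (∀ q, G.Adj p q → ∀ y, (e.conf i).bufR q d = some y → y.color ≠ c) ∧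
    (e.conf (i + 1)).bufR p d = none ∧ (e.conf (i + 1)).bufE p d = some ⟨x.info, p, c⟩ ∧
    (e.conf (i + 1)).queue p d = (e.conf i).queue p d := by
  have := (e.step i).effect p d
  rw [h] at this
  exact this

theorem effect_R3 (h : e.rule i p d = some .R3) : ∃ s x, choice A (e.conf i) p d = some s ∧
    G.Adj p s ∧ hop A (e.conf i) s d = p ∧ (e.conf i).bufE s d = some x ∧
    (e.conf (i + 1)).bufR p d = some ⟨x.info, s, x.color⟩ ∧
    (e.conf (i + 1)).bufE p d = (e.conf i).bufE p d ∧
    (e.conf (i + 1)).queue p d = ((e.conf i).queue p d).erase s ++ [s] := by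
  have hg := e.guard_of_rule h
  obtain ⟨-, s', hs', hne, -⟩ := hg
  have := (e.step i).effect p d
  rw [h] at this
  obtain ⟨s, x, h1, h2⟩ := this
  rw [hs'] at h1
  cases h1
  have hc := choice_candidate hs'
  simp only [Candidate, hne, false_and, or_false] at hc
  exact ⟨s', x, hs', hc.1, hc.2.2, h2⟩

theorem effect_R4 (h : e.rule i p d = some .R4) :
    (e.conf (i + 1)).bufR p d = (e.conf i).bufR p d ∧ (e.conf (i + 1)).bufE p d = none ∧
    (e.conf (i + 1)).queue p d = (e.conf i).queue p d := by
  have := (e.step i).effect p d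
  rw [h] at this
  exact this

theorem effect_R5 (h : e.rule i p d = some .R5) :
    (e.conf (i + 1)).bufR p d = none ∧
    (e.conf (i + 1)).bufE p d = (e.conf i).bufE p d ∧
    (e.conf (i + 1)).queue p d = (e.conf i).queue p d := by
  have := (e.step i).effect p d
  rw [h] at this
  exact this

theorem effect_R6 (h : e.rule i p d = some .R6) :
    (e.conf (i + 1)).bufR p d = (e.conf i).bufR p d ∧ (e.conf (i + 1)).bufE p d = none ∧
    (e.conf (i + 1)).queue p d = (e.conf i).queue p d := by
  have := (e.step i).effect p d
  rw [h] at this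
  exact this

theorem effect_none (h : e.rule i p d = none) :
    (e.conf (i + 1)).bufR p d = (e.conf i).bufR p d ∧
    (e.conf (i + 1)).bufE p d = (e.conf i).bufE p d ∧
    (e.conf (i + 1)).queue p d = (e.conf i).queue p d := by
  have := (e.step i).effect p d
  rw [h] at this
  exact this

/-- Serving a processor only permutes the queue, and every rule writes an admissible `last` field.
The adjacency of `x.last` is what the color argument needs; the queue contents are needed for
finding and counting candidates. -/
theorem wellTyped (i : ℕ) : WellTyped G (e.conf i) := by
  induction i with
  | zero => exact e.init
  | succ i ih =>
    obtain ⟨hR, hE, hQ⟩ := ih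
    have hqueue : ∀ {p d s : V}, s ∈ (e.conf i).queue p d →
        (((e.conf i).queue p d).erase s ++ [s]).Nodup ∧
        ∀ q, q ∈ ((e.conf i).queue p d).erase s ++ [s] ↔ (q = p ∨ G.Adj p q) := by
      intro p d s hs
      have hp : (((e.conf i).queue p d).erase s ++ [s]).Perm ((e.conf i).queue p d) :=
        (List.perm_append_singleton _ _).trans (List.perm_cons_erase hs).symm
      exact ⟨hp.nodup_iff.2 (hQ p d).1, fun q => hp.mem_iff.trans ((hQ p d).2 q)⟩
    have key : ∀ p d,
        (∀ x, (e.conf (i + 1)).bufR p d = some x → x.last = p ∨ G.Adj p x.last) ∧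
        (∀ x, (e.conf (i + 1)).bufE p d = some x → x.last = p ∨ G.Adj p x.last) ∧
        (((e.conf (i + 1)).queue p d).Nodup ∧
          ∀ q, q ∈ (e.conf (i + 1)).queue p d ↔ (q = p ∨ G.Adj p q)) := by
      intro p d
      rcases h : e.rule i p d with _ | _ | _ | _ | _ | _ | _
      · obtain ⟨h1, h2, h3⟩ := e.effect_none h
        rw [h1, h2, h3]; exact ⟨hR p d, hE p d, hQ p d⟩
      · obtain ⟨m, h1, h2, h3⟩ := e.effect_R1 h
        rw [h1, h2, h3]
        refine ⟨?_, hE p d, hqueue (((hQ p d).2 p).2 (Or.inl rfl))⟩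
        rintro x ⟨⟩; exact Or.inl rfl
      · obtain ⟨x, c, -, -, h1, h2, h3⟩ := e.effect_R2 h
        rw [h1, h2, h3]
        refine ⟨by simp, ?_, hQ p d⟩
        rintro x ⟨⟩; exact Or.inl rfl
      · obtain ⟨s, x, -, hadj, -, -, h1, h2, h3⟩ := e.effect_R3 h
        rw [h1, h2, h3]
        refine ⟨?_, hE p d, hqueue (((hQ p d).2 s).2 (Or.inr hadj))⟩
        rintro x ⟨⟩; exact Or.inr hadj
      · obtain ⟨h1, h2, h3⟩ := e.effect_R4 h
        rw [h1, h2, h3]; exact ⟨hR p d, by simp, hQ p d⟩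
      · obtain ⟨h1, h2, h3⟩ := e.effect_R5 h
        rw [h1, h2, h3]; exact ⟨by simp, hE p d, hQ p d⟩
      · obtain ⟨h1, h2, h3⟩ := e.effect_R6 h
        rw [h1, h2, h3]; exact ⟨hR p d, by simp, hQ p d⟩
    exact ⟨fun p d => (key p d).1, fun p d => (key p d).2.1, fun p d => (key p d).2.2⟩

variable {e}

theorem bufE_keep {y : Msg V M G.maxDegree} (h : (e.conf i).bufE p d = some y)
    (h4 : e.rule i p d ≠ some .R4) (h6 : e.rule i p d ≠ some .R6) :
    (e.conf (i + 1)).bufE p d = some y := by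
  rw [← h]
  rcases hr : e.rule i p d with _ | _ | _ | _ | _ | _ | _
  · exact (e.effect_none hr).2.1
  · obtain ⟨m, h1⟩ := e.effect_R1 hr
    exact h1.2.1
  · have := (e.guard_of_rule hr).1
    simp [h] at this
  · obtain ⟨s, x, -, -, -, -, h1⟩ := e.effect_R3 hr
    exact h1.2.1
  · exact absurd hr h4
  · exact (e.effect_R5 hr).2.1
  · exact absurd hr h6

theorem bufE_none_keep (h : (e.conf i).bufE p d = none) (h2 : e.rule i p d ≠ some .R2) :
    (e.conf (i + 1)).bufE p d = none := by
  rcases hr : e.rule i p d with _ | _ | _ | _ | _ | _ | _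
  · exact (e.effect_none hr).2.1.trans h
  · obtain ⟨m, h1⟩ := e.effect_R1 hr
    exact h1.2.1.trans h
  · exact absurd hr h2
  · obtain ⟨s, x, -, -, -, -, h1⟩ := e.effect_R3 hr
    exact h1.2.1.trans h
  · exact (e.effect_R4 hr).2.1
  · exact (e.effect_R5 hr).2.1.trans h
  · exact (e.effect_R6 hr).2.1

/-- A full reception buffer is kept, with the queue, unless `R2` or `R5` empties it. -/
theorem bufR_keep {x : Msg V M G.maxDegree} (h : (e.conf i).bufR p d = some x)
    (h2 : e.rule i p d ≠ some .R2) (h5 : e.rule i p d ≠ some .R5) :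
    (e.conf (i + 1)).bufR p d = some x ∧ (e.conf (i + 1)).queue p d = (e.conf i).queue p d := by
  rw [← h]
  rcases hr : e.rule i p d with _ | _ | _ | _ | _ | _ | _
  · exact ⟨(e.effect_none hr).1, (e.effect_none hr).2.2⟩
  · have := (e.guard_of_rule hr).2.1
    simp [h] at this
  · exact absurd hr h2
  · have := (e.guard_of_rule hr).1
    simp [h] at this
  · exact ⟨(e.effect_R4 hr).1, (e.effect_R4 hr).2.2⟩
  · exact absurd hr h5
  · exact ⟨(e.effect_R6 hr).1, (e.effect_R6 hr).2.2⟩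

/-- An empty reception buffer is kept, with the queue, unless `R1` or `R3` fills it. -/
theorem bufR_none_keep (h : (e.conf i).bufR p d = none)
    (h1 : e.rule i p d ≠ some .R1) (h3 : e.rule i p d ≠ some .R3) :
    (e.conf (i + 1)).bufR p d = none ∧ (e.conf (i + 1)).queue p d = (e.conf i).queue p d := by
  rcases hr : e.rule i p d with _ | _ | _ | _ | _ | _ | _
  · exact ⟨(e.effect_none hr).1.trans h, (e.effect_none hr).2.2⟩
  · exact absurd hr h1
  · obtain ⟨x, c, hx, -⟩ := e.effect_R2 hr
    simp [h] at hx
  · exact absurd hr h3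
  · exact ⟨(e.effect_R4 hr).1.trans h, (e.effect_R4 hr).2.2⟩
  · exact ⟨(e.effect_R5 hr).1, (e.effect_R5 hr).2.2⟩
  · exact ⟨(e.effect_R6 hr).1.trans h, (e.effect_R6 hr).2.2⟩

/-- A message that appears in a reception buffer was generated there or copied from the emission
buffer of the processor that it names. -/
theorem bufR_new {x : Msg V M G.maxDegree} (h' : (e.conf (i + 1)).bufR p d = some x) :
    ((e.conf i).bufR p d = some x ∧ e.rule i p d ≠ some .R2 ∧ e.rule i p d ≠ some .R5) ∨
    x.last = p ∨
    (G.Adj p x.last ∧ e.rule i p d = some .R3 ∧ choice A (e.conf i) p d = some x.last ∧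
      hop A (e.conf i) x.last d = p ∧
      ∃ y, (e.conf i).bufE x.last d = some y ∧ y.info = x.info ∧ y.color = x.color) := by
  rcases hr : e.rule i p d with _ | _ | _ | _ | _ | _ | _
  · exact Or.inl ⟨(e.effect_none hr).1.symm.trans h', by simp, by simp⟩
  · obtain ⟨m, h1, -⟩ := e.effect_R1 hr
    rw [h1] at h'
    cases h'
    exact Or.inr (Or.inl rfl)
  · obtain ⟨x, c, -, -, h1, -⟩ := e.effect_R2 hr
    simp [h1] at h'
  · obtain ⟨s, y, hs, hadj, hh, hy, h1, -⟩ := e.effect_R3 hr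
    rw [h1] at h'
    cases h'
    exact Or.inr (Or.inr ⟨hadj, rfl, hs, hh, y, hy, rfl, rfl⟩)
  · exact Or.inl ⟨(e.effect_R4 hr).1.symm.trans h', by simp, by simp⟩
  · simp [(e.effect_R5 hr).1] at h'
  · exact Or.inl ⟨(e.effect_R6 hr).1.symm.trans h', by simp, by simp⟩

end Execution

/-- The message `x` in `bufR_p(d)` is not waiting for its source copy to be erased. -/
def Released (γ : Config V M σ G.maxDegree) (p d : V) (x : Msg V M G.maxDegree) : Prop :=
  x.last = p ∨ ¬ SameInfoColor (γ.bufE x.last d) x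

/-! ### Invariants that keep a generated message from being lost -/

namespace Execution

variable {e : Execution A M} {i : ℕ} {p d : V}

/-- The colors chosen by `R2` never block a released message again. -/
theorem released_succ {x : Msg V M G.maxDegree} (hx : (e.conf i).bufR p d = some x)
    (hr : Released (e.conf i) p d x) : Released (e.conf (i + 1)) p d x := by
  rcases hr with h | h
  · exact Or.inl h
  by_cases hlast : x.last = p
  · exact Or.inl hlast
  have hadj : G.Adj p x.last := ((e.wellTyped i).1 p d x hx).resolve_left hlast
  refine Or.inr fun hs => ?_
  -- Only `R2` can put new content into the source's emission buffer, and its color avoids that of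
  -- `x`, which lies in a neighbour's reception buffer.
  by_cases h2 : e.rule i x.last d = some .R2
  · obtain ⟨z, c, -, hc, -, hE, -⟩ := e.effect_R2 h2
    obtain ⟨y, hy, -, hyc⟩ := hs
    rw [hE] at hy
    cases hy
    exact hc p hadj.symm x hx hyc.symm
  · cases hE : (e.conf i).bufE x.last d with
    | none =>
      obtain ⟨y, hy, -⟩ := hs
      simp [bufE_none_keep hE h2] at hy
    | some z =>
      by_cases h46 : e.rule i x.last d = some .R4 ∨ e.rule i x.last d = some .R6
      · have : (e.conf (i + 1)).bufE x.last d = none :=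
          h46.elim (fun h => (e.effect_R4 h).2.1) (fun h => (e.effect_R6 h).2.1)
        obtain ⟨y, hy, -⟩ := hs
        simp [this] at hy
      · push Not at h46
        rw [bufE_keep hE h46.1 h46.2, ← hE] at hs
        exact h hs

/-- The message generated by `p` in step `t` is in `bufR_q(d)`, released. -/
def InReception (e : Execution A M) (t : ℕ) (p d : V) (i : ℕ) (q : V) : Prop :=
  e.Carries t p d i (.R q) ∧ ∃ x, (e.conf i).bufR q d = some x ∧ Released (e.conf i) q d x

/-- The message generated by `p` in step `t` is in `bufE_q(d)`, and what looks like a copy of it in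
the reception buffers of the neighbours is one. -/
def InEmission (e : Execution A M) (t : ℕ) (p d : V) (i : ℕ) (q : V) : Prop :=
  e.Carries t p d i (.E q) ∧ ∃ y, (e.conf i).bufE q d = some y ∧
    ∀ r, G.Adj q r → (e.conf i).bufR r d = some ⟨y.info, q, y.color⟩ → e.Carries t p d i (.R r)

variable {t : ℕ} {q : V}

theorem inReception_of_generates (h : e.Generates t p d) : e.InReception t p d (t + 1) p := by
  obtain ⟨m, h1, -⟩ := e.effect_R1 h
  exact ⟨.gen h, _, h1, Or.inl rfl⟩

theorem InReception.not_R5 (h : e.InReception t p d i q) : e.rule i q d ≠ some .R5 := by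
  intro hr
  obtain ⟨-, x, hx, hrel⟩ := h
  obtain ⟨y, hy, h1, h2, -⟩ := e.guard_of_rule hr
  rw [hx] at hy
  cases hy
  exact hrel.elim h1 (fun h => h h2)

theorem InReception.keep (h : e.InReception t p d i q) (h2 : e.rule i q d ≠ some .R2) :
    e.InReception t p d (i + 1) q := by
  have h5 := h.not_R5
  obtain ⟨hc, x, hx, hrel⟩ := h
  exact ⟨.keepR hc h2 h5, x, (bufR_keep hx h2 h5).1, released_succ hx hrel⟩

/-- The new color rules out older look-alikes at the neighbours. None can be copied from `q` in the
same step either, because the guard of `R2` requires the emission buffer of `q` to be empty. -/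
theorem InReception.forward (h : e.InReception t p d i q) (h2 : e.rule i q d = some .R2) :
    e.InEmission t p d (i + 1) q := by
  obtain ⟨x, c, -, hc, -, hE, -⟩ := e.effect_R2 h2
  refine ⟨.move h.1 h2, _, hE, fun r hqr hr => ?_⟩
  rcases bufR_new hr with ⟨h1, -⟩ | h1 | ⟨-, -, -, -, y, hy, -⟩
  · exact absurd rfl (hc r hqr _ h1)
  · exact absurd h1 hqr.ne
  · have := (e.guard_of_rule h2).1
    simp only at hy
    simp [this] at hy

/-- A look-alike that appears during the step names `q` as its source, so `R3` has just copied it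
from the emission buffer of `q` and it is genuine. -/
theorem InEmission.keep (h : e.InEmission t p d i q) (h4 : e.rule i q d ≠ some .R4)
    (h6 : e.rule i q d ≠ some .R6) : e.InEmission t p d (i + 1) q := by
  obtain ⟨hc, y, hy, hcopy⟩ := h
  refine ⟨.keepE hc h4 h6, y, bufE_keep hy h4 h6, fun r hqr hr => ?_⟩
  rcases bufR_new hr with ⟨h1, h2, h5⟩ | h1 | ⟨-, h3, hch, -⟩
  · exact .keepR (hcopy r hqr h1) h2 h5
  · exact absurd h1 hqr.ne
  · exact .copy hc h3 hch

/-- The copy seen by the guard of `R4` is genuine by the invariant. It survives the step: the still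
full source blocks `R2`, and `R5` does not apply at the next hop. Erasing the source then releases
it. -/
theorem InEmission.forward (h : e.InEmission t p d i q) (h4 : e.rule i q d = some .R4) :
    q ≠ d ∧ e.InReception t p d (i + 1) (hop A (e.conf i) q d) := by
  obtain ⟨hc, y, hy, hcopy⟩ := h
  obtain ⟨y', hy', hqd, hbR, -⟩ := e.guard_of_rule h4
  rw [hy] at hy'
  cases hy'
  have hadj : G.Adj q (hop A (e.conf i) q d) := A.nextHop_adj _ _ _ hqd
  have hc' := hcopy _ hadj hbR
  have hsame : SameInfoColor ((e.conf i).bufE q d) ⟨y.info, q, y.color⟩ := ⟨y, hy, rfl, rfl⟩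
  have h2 : e.rule i (hop A (e.conf i) q d) d ≠ some .R2 := by
    intro h2
    obtain ⟨-, x, hx, hrel⟩ := e.guard_of_rule h2
    rw [hbR] at hx
    cases hx
    exact hrel.elim hadj.ne fun h => h hsame
  have h5 : e.rule i (hop A (e.conf i) q d) d ≠ some .R5 := by
    intro h5
    obtain ⟨x, hx, -, -, hh⟩ := e.guard_of_rule h5
    rw [hbR] at hx
    cases hx
    exact hh rfl
  refine ⟨hqd, .keepR hc' h2 h5, _, (bufR_keep hbR h2 h5).1, Or.inr ?_⟩
  rintro ⟨z, hz, -⟩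
  simp only at hz
  simp [(e.effect_R4 h4).2.1] at hz

/-- The message is never lost: until it is delivered, it is in some buffer. -/
theorem exists_buffer_of_generates (hg : e.Generates t p d) {i : ℕ} (hi : t + 1 ≤ i) :
    (∃ t', t < t' ∧ t' < i ∧ e.Delivers t p d t') ∨
      ∃ q, e.InReception t p d i q ∨ e.InEmission t p d i q := by
  induction i, hi using Nat.le_induction with
  | base => exact Or.inr ⟨p, Or.inl (inReception_of_generates hg)⟩
  | succ i hi ih =>
    rcases ih with ⟨t', h1, h2, h3⟩ | ⟨q, h | h⟩
    · exact Or.inl ⟨t', h1, by omega, h3⟩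
    · right
      by_cases h2 : e.rule i q d = some .R2
      · exact ⟨q, Or.inr (h.forward h2)⟩
      · exact ⟨q, Or.inl (h.keep h2)⟩
    · by_cases h4 : e.rule i q d = some .R4
      · exact Or.inr ⟨_, Or.inl (h.forward h4).2⟩
      · by_cases h6 : e.rule i q d = some .R6
        · obtain rfl : q = d := (e.guard_of_rule h6).1
          exact Or.inl ⟨i, by omega, by omega, h.1, h6⟩
        · exact Or.inr ⟨q, Or.inr (h.keep h4 h6)⟩

/-! ### Stabilization of the routing tables -/

/-- From configuration `i₀` on, the routing tables are correct and do not change. -/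
structure Stable (e : Execution A M) (i₀ : ℕ) : Prop where
  silent : ∀ k, i₀ ≤ k → ∀ p, ¬ A.Enabled (e.conf k).route p
  route_eq : ∀ k, i₀ ≤ k → (e.conf k).route = (e.conf i₀).route
  correct : A.Correct (e.conf i₀).route

theorem stable_of_silent {i₀ : ℕ} (hs : ∀ p, ¬ A.Enabled (e.conf i₀).route p)
    (hc : A.Correct (e.conf i₀).route) : e.Stable i₀ := by
  have key : ∀ k, i₀ ≤ k → (e.conf k).route = (e.conf i₀).route := by
    intro k hk
    induction k, hk using Nat.le_induction with
    | base => rfl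
    | succ k hk ih =>
      rw [← ih]
      funext p
      by_cases hp : e.chosen k p
      · exact ((e.step k).forwarding p hp (by rw [ih]; exact hs p)).1
      · exact ((e.step k).idle p hp).1
  exact ⟨fun k hk p => by rw [key k hk]; exact hs p, key, hc⟩

/-- The routing algorithm, observed from configuration `s` on, executes as if it were alone. -/
theorem isExecution_route (e : Execution A M) (s : ℕ) :
    A.IsExecution (fun i => (e.conf (s + i)).route)
      (fun i p => e.chosen (s + i) p ∧ A.Enabled (e.conf (s + i)).route p) where
  step i p h := ((e.step (s + i)).routing p h.1 h.2).1
  idle i p h := by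
    by_cases hp : e.chosen (s + i) p
    · exact ((e.step (s + i)).forwarding p hp fun ha => h ⟨hp, ha⟩).1
    · exact ((e.step (s + i)).idle p hp).1
  fair p i hen := by
    have hen' : ∀ j, s + i ≤ j → A.Enabled (e.conf j).route p := fun j hj => by
      have := hen (j - s) (by omega)
      simpa only [show s + (j - s) = j by omega] using this
    obtain ⟨j, hj, hc⟩ := e.fair p (s + i) fun j hj => Or.inl (hen' j hj)
    refine ⟨j - s, by omega, ?_⟩
    simp only [show s + (j - s) = j by omega]
    exact ⟨hc, hen' j hj⟩

/-- The projection of the execution to the routing variables is an execution of `A` alone, whose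
rounds are compared one by one with those of the composition. -/
theorem exists_stable {R : ℕ} (hR : A.StabilizesWithin R) (e : Execution A M) (s : ℕ) :
    ∃ i₀, s ≤ i₀ ∧ i₀ ≤ e.roundEnd s R ∧ e.Stable i₀ := by
  have hx := isExecution_route e s
  obtain ⟨hc, hs⟩ := hR _ _ hx
  refine ⟨s + SSMFP.roundEnd _ _ 0 R, by omega, ?_, stable_of_silent hs hc⟩
  generalize hen : (fun i p => A.Enabled (e.conf (s + i)).route p) = en at hx ⊢
  have hfair := hx.fair
  rw [hen] at hfair
  generalize hact : (fun i p => e.chosen (s + i) p ∧ A.Enabled (e.conf (s + i)).route p) = act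
    at hfair ⊢
  have key : ∀ i j, s + i ≤ j →
      s + nextRound en act i ≤ nextRound (fun i p => Enabled A (e.conf i) p) e.chosen j := by
    intro i j hij
    refine le_trans ?_ (nextRound_mono e.fair hij)
    have hcov := nextRound_covers e.fair (s + i)
    set N := nextRound (fun i p => Enabled A (e.conf i) p) e.chosen (s + i) with hN
    have hlt := hcov.1
    suffices hcov' : CoversRound en act i (N - s) by
      have := Nat.sInf_le (s := {j | CoversRound en act i j}) hcov'
      change nextRound en act i ≤ N - s at this
      omega
    refine ⟨by omega, fun p hp => ?_⟩
    by_contra! hcon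
    have hact' : ∀ k, i ≤ k → k < N - s → en k p → ¬ e.chosen (s + k) p := by
      intro k hk hk' he hch
      apply (hcon k hk hk').1
      rw [← hact]
      exact ⟨hch, by rw [← hen] at he; exact he⟩
    -- If `p` neither acts for `A` nor is neutralized for `A`, it stays enabled for `A`. Then it is
    -- not neutralized in the composition either, so it is chosen, and by priority this is an action
    -- of `A`.
    have hall : ∀ k, i ≤ k → k ≤ N - s → en k p := by
      intro k hk
      induction k, hk using Nat.le_induction with
      | base => exact fun _ => hp
      | succ k hk ih =>
        intro hk'
        by_contra hne
        exact (hcon k hk (by omega)).2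
          ⟨ih (by omega), hne, fun ha => (hcon k hk (by omega)).1 ha⟩
    have hall' : ∀ k, s + i ≤ k → k ≤ N → A.Enabled (e.conf k).route p := by
      intro k hk hk'
      have := hall (k - s) (by omega) (by omega)
      rw [← hen] at this
      simpa only [show s + (k - s) = k by omega] using this
    obtain ⟨k, hk, hk', ha | ha⟩ := hcov.2 p (Or.inl (hall' (s + i) le_rfl (by omega)))
    · refine hact' (k - s) (by omega) (by omega) (hall _ (by omega) (by omega)) ?_
      rwa [show s + (k - s) = k by omega]
    · exact ha.2.1 (Or.inl (hall' (k + 1) (by omega) (by omega)))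
  have hiter : ∀ K, s + SSMFP.roundEnd en act 0 K ≤ e.roundEnd s K := by
    intro K
    induction K with
    | zero => exact le_rfl
    | succ K ih =>
      simp only [Execution.roundEnd, SSMFP.roundEnd, Function.iterate_succ_apply'] at ih ⊢
      exact key _ _ ih
  exact hiter R

end Execution

end Steps

/-! ### Local waiting times once the tables are correct -/

section Liveness

variable {V : Type u} [Fintype V] [DecidableEq V] {G : SimpleGraph V} [DecidableRel G.Adj]
  {M : Type v} {σ : Type w} {A : RoutingAlgorithm G σ}

namespace Execution

variable {e : Execution A M} {i₀ i k : ℕ} {p q n d : V}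

theorem Stable.hop_eq (hst : e.Stable i₀) (hk : i₀ ≤ k) (p d : V) :
    hop A (e.conf k) p d = hop A (e.conf i₀) p d := by
  rw [hop, hop, hst.route_eq k hk]

theorem Stable.dist_hop (hst : e.Stable i₀) (hpd : p ≠ d) :
    G.dist (hop A (e.conf i₀) p d) d + 1 = G.dist p d :=
  hst.correct p d hpd

theorem Stable.exists_rule (hst : e.Stable i₀) (hk : i₀ ≤ k) (hc : e.chosen k p) {r : Rule}
    (hg : Guard A (e.conf k) p d r) : ∃ r', e.rule k p d = some r' := by
  rcases ((e.step k).forwarding p hc (hst.silent k hk p)).2 d with ⟨r', h, -⟩ | ⟨-, h⟩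
  · exact ⟨r', h⟩
  · exact absurd hg (h r)

/-- The emission buffer of `p` is emptied in step `j`. -/
def EmptiesE (e : Execution A M) (j : ℕ) (p d : V) : Prop :=
  e.rule j p d = some .R4 ∨ e.rule j p d = some .R6

/-- The reception buffer of `p` is emptied in step `j`. -/
def EmptiesR (e : Execution A M) (j : ℕ) (p d : V) : Prop :=
  e.rule j p d = some .R2 ∨ e.rule j p d = some .R5

/-- The reception buffer of `p` is filled in step `j`. -/
def FillsR (e : Execution A M) (j : ℕ) (p d : V) : Prop :=
  e.rule j p d = some .R1 ∨ e.rule j p d = some .R3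

theorem EmptiesE.bufE_eq (h : e.EmptiesE k p d) : (e.conf (k + 1)).bufE p d = none :=
  h.elim (fun h => (e.effect_R4 h).2.1) (fun h => (e.effect_R6 h).2.1)

theorem EmptiesR.bufR_eq (h : e.EmptiesR k p d) : (e.conf (k + 1)).bufR p d = none := by
  rcases h with h | h
  · obtain ⟨x, c, -, -, h1, -⟩ := e.effect_R2 h
    exact h1
  · exact (e.effect_R5 h).1

theorem bufE_succ {y : Msg V M G.maxDegree} (h : (e.conf k).bufE p d = some y)
    (hn : ¬ e.EmptiesE k p d) : (e.conf (k + 1)).bufE p d = some y :=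
  bufE_keep h (fun h => hn (Or.inl h)) (fun h => hn (Or.inr h))

theorem bufR_succ {x : Msg V M G.maxDegree} (h : (e.conf k).bufR p d = some x)
    (hn : ¬ e.EmptiesR k p d) : (e.conf (k + 1)).bufR p d = some x ∧
      (e.conf (k + 1)).queue p d = (e.conf k).queue p d :=
  bufR_keep h (fun h => hn (Or.inl h)) (fun h => hn (Or.inr h))

/-- The number of rules that `p` can still execute on its reception buffer while its emission
buffer is full. -/
def receptionRank (γ : Config V M σ G.maxDegree) (A : RoutingAlgorithm G σ) (p d : V) : ℕ :=
  match γ.bufR p d with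
  | none => 1
  | some x => if x.last = p ∨ hop A γ x.last d = p then 0 else 2

/-- The full emission buffer disables `R2`. `R5` lowers the rank from 2 to 1, and `R1` or `R3` from
1 to 0, since what they write comes from `p` itself or from a processor whose next hop is `p`, and
`R5` never applies to it. -/
theorem Stable.receptionRank_step (hst : e.Stable i₀) (hk : i₀ ≤ k)
    (hE : (e.conf k).bufE p d ≠ none) (hn : ¬ e.EmptiesE k p d) :
    receptionRank (e.conf (k + 1)) A p d ≤ receptionRank (e.conf k) A p d ∧
    ((∃ r, e.rule k p d = some r) →
      receptionRank (e.conf (k + 1)) A p d < receptionRank (e.conf k) A p d) := by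
  have hhop : ∀ q, hop A (e.conf (k + 1)) q d = hop A (e.conf k) q d := fun q => by
    rw [hst.hop_eq hk, hst.hop_eq (hk.trans k.le_succ)]
  rcases hr : e.rule k p d with _ | _ | _ | _ | _ | _ | _
  · simp [receptionRank, (e.effect_none hr).1, hhop]
  · obtain ⟨m, h1, -⟩ := e.effect_R1 hr
    simp [receptionRank, h1, (e.guard_of_rule hr).2.1]
  · exact absurd (e.guard_of_rule hr).1 hE
  · obtain ⟨s, x, -, -, hh, -, h1, -⟩ := e.effect_R3 hr
    simp [receptionRank, h1, (e.guard_of_rule hr).1, hhop, hh]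
  · exact absurd (Or.inl hr) hn
  · obtain ⟨x, hx, hl, -, hh⟩ := e.guard_of_rule hr
    simp [receptionRank, (e.effect_R5 hr).1, hx, hl, hh]
  · exact absurd (Or.inr hr) hn

/-- A permanently enabled `R4` or `R6` is executed within three rounds. -/
theorem Stable.emptiesE_of_guard (hst : e.Stable i₀) {Q : ℕ → Prop}
    (hQ : ∀ k, Q k → i₀ ≤ k ∧ (Guard A (e.conf k) p d .R4 ∨ Guard A (e.conf k) p d .R6))
    (hstep : ∀ k, Q k → ¬ e.EmptiesE k p d → Q (k + 1)) (hi : Q i) :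
    ∃ j, i ≤ j ∧ j < e.roundEnd i 3 ∧ e.EmptiesE j p d := by
  -- The rank, at most 2, counts how often `p` can execute a reception rule instead of `R4` or `R6`.
  refine exists_event_of_rank e.fair (p := p) (P := Q) (G := fun j => e.EmptiesE j p d)
    (f := fun k => receptionRank (e.conf k) A p d)
    (fun k hk => Or.inr ((hQ k hk).2.elim (fun h => ⟨d, _, h⟩) (fun h => ⟨d, _, h⟩)))
    (fun k hk hn => ?_) 2 i hi ?_
  · obtain ⟨hk0, hg⟩ := hQ k hk
    have hE : (e.conf k).bufE p d ≠ none := by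
      rcases hg with ⟨x, hx, -⟩ | ⟨-, hx⟩
      · simp [hx]
      · exact hx
    obtain ⟨h1, h2⟩ := hst.receptionRank_step hk0 hE hn
    exact ⟨hstep k hk hn, h1, fun hc => h2 (hg.elim (hst.exists_rule hk0 hc)
      (hst.exists_rule hk0 hc))⟩
  · simp only [receptionRank]
    split
    · omega
    · split <;> omega

/-- `1` if the emission buffer is full, `0` otherwise. -/
def emissionRank (γ : Config V M σ G.maxDegree) (p d : V) : ℕ :=
  match γ.bufE p d with
  | none => 0
  | some _ => 1

/-- If `R2` is disabled and a rule that concerns the reception buffer is enabled until `F` happens,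
where `F` happens as soon as a rule other than `R4` and `R6` is executed, then `F` happens within
two rounds. -/
theorem Stable.event_of_guard (hst : e.Stable i₀) {Q F : ℕ → Prop}
    (hQ : ∀ k, Q k → i₀ ≤ k ∧ ∃ r, Guard A (e.conf k) p d r)
    (hF : ∀ k, Q k → ¬ F k → ∀ r, e.rule k p d = some r → e.EmptiesE k p d)
    (hstep : ∀ k, Q k → ¬ F k → Q (k + 1)) (hi : Q i) :
    ∃ j, i ≤ j ∧ j < e.roundEnd i 2 ∧ F j := by
  -- Before `F`, `p` can only empty its emission buffer, and only once, since refilling it takes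
  -- `R2`.
  refine exists_event_of_rank e.fair (p := p) (P := Q) (G := F)
    (f := fun k => emissionRank (e.conf k) p d)
    (fun k hk => Or.inr ⟨d, (hQ k hk).2⟩) (fun k hk hn => ⟨hstep k hk hn, ?_⟩) 1 i hi ?_
  · obtain ⟨hk0, r, hg⟩ := hQ k hk
    have hfall : e.EmptiesE k p d →
        emissionRank (e.conf (k + 1)) p d < emissionRank (e.conf k) p d := by
      intro hE
      have h1 : (e.conf k).bufE p d ≠ none := by
        rcases hE with h | h
        · obtain ⟨x, hx, -⟩ := e.guard_of_rule h
          simp [hx]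
        · exact (e.guard_of_rule h).2
      obtain ⟨y, hy⟩ := Option.ne_none_iff_exists'.1 h1
      simp [emissionRank, hE.bufE_eq, hy]
    refine ⟨?_, fun hc => ?_⟩
    · rcases hr : e.rule k p d with _ | r'
      · simp [emissionRank, (e.effect_none hr).2.1]
      · exact (hfall (hF k hk hn r' hr)).le
    · obtain ⟨r', hr⟩ := hst.exists_rule hk0 hc hg
      exact hfall (hF k hk hn r' hr)
  · simp only [emissionRank]
    split <;> omega

/-- A copy in the reception buffer of a processor which is not the next hop is erased within two
rounds, unless the source is erased before. -/
theorem Stable.duplicate (hst : e.Stable i₀) (hi : i₀ ≤ i) {x y : Msg V M G.maxDegree} {r : V}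
    (hx : (e.conf i).bufR r d = some x) (hl : x.last ≠ r)
    (hy : (e.conf i).bufE x.last d = some y) (hxy : y.info = x.info ∧ y.color = x.color)
    (hh : hop A (e.conf i₀) x.last d ≠ r) :
    ∃ j, i ≤ j ∧ j < e.roundEnd i 2 ∧ (e.EmptiesR j r d ∨ e.EmptiesE j x.last d) := by
  refine hst.event_of_guard (p := r) (d := d)
    (Q := fun k => i₀ ≤ k ∧ (e.conf k).bufR r d = some x ∧ (e.conf k).bufE x.last d = some y)
    (fun k hk => ⟨hk.1, .R5, x, hk.2.1, hl, ⟨y, hk.2.2, hxy⟩, ?_⟩) (fun k hk hn r' hr => ?_)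
    (fun k hk hn => ⟨by omega, (bufR_succ hk.2.1 fun h => hn (Or.inl h)).1,
      bufE_succ hk.2.2 fun h => hn (Or.inr h)⟩) ⟨hi, hx, hy⟩
  · rwa [hst.hop_eq hk.1]
  · cases r' with
    | R1 => simpa [hk.2.1] using (e.guard_of_rule hr).2.1
    | R2 => exact absurd (Or.inl (Or.inl hr)) hn
    | R3 => simpa [hk.2.1] using (e.guard_of_rule hr).1
    | R4 => exact Or.inl hr
    | R5 => exact absurd (Or.inl (Or.inr hr)) hn
    | R6 => exact Or.inr hr

/-- Once the next hop has copied the message of `bufE_p(d)`, this buffer is emptied within five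
rounds. -/
theorem Stable.emptiesE_of_copied (hst : e.Stable i₀) (hi : i₀ ≤ i) (hpd : p ≠ d)
    {y : Msg V M G.maxDegree} (hy : (e.conf i).bufE p d = some y)
    (hx : (e.conf i).bufR (hop A (e.conf i₀) p d) d = some ⟨y.info, p, y.color⟩) :
    ∃ j, i ≤ j ∧ j < e.roundEnd i 5 ∧ e.EmptiesE j p d := by
  by_contra! hno
  have hadj : G.Adj p (hop A (e.conf i₀) p d) := A.nextHop_adj _ _ _ hpd
  set n := hop A (e.conf i₀) p d with hn
  have hle : e.roundEnd i 2 ≤ e.roundEnd i 5 := roundEnd_mono_right e.fair i (by omega)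
  set N := e.roundEnd i 2 with hN
  have hiN : i ≤ N := le_roundEnd e.fair i 2
  let S : ℕ → Prop := fun k => i₀ ≤ k ∧ (e.conf k).bufE p d = some y ∧
    (e.conf k).bufR n d = some ⟨y.info, p, y.color⟩
  -- The copy at the next hop stays: its full source blocks `R2`, and `R5` requires a different next
  -- hop.
  have hS : ∀ k, S k → ¬ e.EmptiesE k p d → S (k + 1) := by
    rintro k ⟨h0, h1, h2⟩ hne
    refine ⟨by omega, bufE_succ h1 hne, (bufR_succ h2 ?_).1⟩
    rintro (h | h)
    · obtain ⟨-, x, hx, hrel⟩ := e.guard_of_rule h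
      rw [h2] at hx
      cases hx
      exact hrel.elim hadj.ne fun h => h ⟨y, h1, rfl, rfl⟩
    · obtain ⟨x, hx, -, -, hh⟩ := e.guard_of_rule h
      rw [h2] at hx
      cases hx
      exact hh (hst.hop_eq h0 p d)
  let D : V → ℕ → Prop := fun r k => (e.conf k).bufR r d ≠ some ⟨y.info, p, y.color⟩
  -- A removed duplicate does not come back, because only the next hop `n` can copy from `p`.
  have hD : ∀ r, G.Adj p r → r ≠ n → ∀ k, S k ∧ D r k → D r (k + 1) := by
    rintro r hr hrn k ⟨⟨h0, h1, h2⟩, hD⟩ h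
    rcases bufR_new h with ⟨h, -⟩ | h | ⟨-, -, -, h, -⟩
    · exact hD h
    · exact hr.ne h
    · exact hrn (h.symm.trans (hst.hop_eq h0 p d))
  have hSD : ∀ r, G.Adj p r → r ≠ n → ∀ k, S k ∧ D r k → ¬ e.EmptiesE k p d →
      S (k + 1) ∧ D r (k + 1) := fun r hr hrn k hk hne => ⟨hS k hk.1 hne, hD r hr hrn k hk⟩
  have hSi : ∀ k, i ≤ k → k ≤ N → S k := fun k hk hkN =>
    persists hS (fun m h1 h2 => hno m h1 (by omega)) ⟨hi, hy, hx⟩ hk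
  -- All neighbours other than `n` lose their duplicates in parallel within the same two rounds; the
  -- other three of the five rounds are for `R4`.
  have hDN : ∀ r, G.Adj p r → r ≠ n → D r N := by
    intro r hr hrn
    by_cases hDi : D r i
    · exact (persists (hSD r hr hrn) (fun m h1 h2 => hno m h1 (by omega)) ⟨hSi i le_rfl hiN, hDi⟩
        hiN).2
    · have hDi' : (e.conf i).bufR r d = some ⟨y.info, p, y.color⟩ := not_not.1 hDi
      obtain ⟨j, hj, hjN, h | h⟩ := hst.duplicate hi hDi' hr.ne hy ⟨rfl, rfl⟩ hrn.symm
      · have hj1 : D r (j + 1) := by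
          intro h'
          rw [h.bufR_eq] at h'
          cases h'
        exact (persists (hSD r hr hrn) (fun m h1 h2 => hno m (by omega) (by omega))
          ⟨hSi (j + 1) (by omega) hjN, hj1⟩ hjN).2
      · exact absurd h (hno j hj (by omega))
  obtain ⟨j, hj, hj', h⟩ := hst.emptiesE_of_guard (p := p) (d := d) (i := N)
    (Q := fun k => S k ∧ ∀ r, G.Adj p r → r ≠ n → D r k)
    (fun k ⟨⟨h0, h1, h2⟩, h3⟩ => ⟨h0, Or.inl ⟨y, h1, hpd, by rwa [hst.hop_eq h0],
      by rwa [hst.hop_eq h0]⟩⟩)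
    (fun k hk hne => ⟨hS k hk.1 hne, fun r hr hrn => hD r hr hrn k ⟨hk.1, hk.2 r hr hrn⟩⟩)
    ⟨hSi N hiN le_rfl, hDN⟩
  exact hno j (by omega) (hj'.trans_le (roundEnd_trans e.fair le_rfl)) h

/-- An empty reception buffer for which there is a candidate is filled within two rounds. -/
theorem Stable.fillsR (hst : e.Stable i₀) (hi : i₀ ≤ i) (hadj : G.Adj n p)
    (hh : hop A (e.conf i₀) p d = n) {y : Msg V M G.maxDegree}
    (hy : (e.conf i).bufE p d = some y) (hR : (e.conf i).bufR n d = none) :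
    ∃ j, i ≤ j ∧ j < e.roundEnd i 2 ∧ (e.FillsR j n d ∨ e.EmptiesE j p d) := by
  refine hst.event_of_guard (p := n) (d := d)
    (Q := fun k => i₀ ≤ k ∧ (e.conf k).bufR n d = none ∧ (e.conf k).bufE p d = some y)
    (fun k hk => ⟨hk.1, ?_⟩) (fun k hk hn r' hr => ?_)
    (fun k hk hn => ⟨by omega, (bufR_none_keep hk.2.1 (fun h => hn (Or.inl (Or.inl h)))
      fun h => hn (Or.inl (Or.inr h))).1,
      bufE_succ hk.2.2 fun h => hn (Or.inr h)⟩) ⟨hi, hR, hy⟩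
  · obtain ⟨h0, h1, h2⟩ := hk
    have hcand : Candidate A (e.conf k) n d p :=
      Or.inl ⟨hadj, by simp [h2], by rwa [hst.hop_eq h0]⟩
    have hmem : p ∈ (e.conf k).queue n d := (((e.wellTyped k).2.2 n d).2 p).2 (Or.inr hadj)
    -- The chosen candidate may vary from step to step, but whichever it is, `R1` or `R3` is
    -- enabled.
    obtain ⟨s, hs⟩ : ∃ s, choice A (e.conf k) n d = some s := by
      rw [← Option.isSome_iff_exists, choice, List.find?_isSome]
      exact ⟨p, hmem, by simpa using hcand⟩
    by_cases hsn : s = n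
    · subst hsn
      rcases choice_candidate hs with h | h
      · exact absurd h.1 (G.irrefl)
      · exact ⟨.R1, h.2, h1, hs⟩
    · rcases choice_candidate hs with h | h
      · exact ⟨.R3, h1, s, hs, hsn, h.2.1⟩
      · exact absurd h.1 hsn
  · cases r' with
    | R1 => exact absurd (Or.inl (Or.inl hr)) hn
    | R2 =>
      obtain ⟨-, x, hx, -⟩ := e.guard_of_rule hr
      simp [hk.2.1] at hx
    | R3 => exact absurd (Or.inl (Or.inr hr)) hn
    | R4 => exact Or.inl hr
    | R5 =>
      obtain ⟨x, hx, -⟩ := e.guard_of_rule hr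
      simp [hk.2.1] at hx
    | R6 => exact Or.inr hr

/-- A released message moves to an empty emission buffer in one round. -/
theorem Stable.emptiesR_of_released (hst : e.Stable i₀) (hi : i₀ ≤ i) {x : Msg V M G.maxDegree}
    (hx : (e.conf i).bufR p d = some x) (hrel : Released (e.conf i) p d x)
    (hE : (e.conf i).bufE p d = none) :
    ∃ j, i ≤ j ∧ j < e.roundEnd i 1 ∧ e.EmptiesR j p d := by
  have hen : ∀ k, (i₀ ≤ k ∧ (e.conf k).bufR p d = some x ∧ Released (e.conf k) p d x ∧
      (e.conf k).bufE p d = none) → Guard A (e.conf k) p d .R2 :=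
    fun k hk => ⟨hk.2.2.2, x, hk.2.1, hk.2.2.1⟩
  refine exists_event_of_rank e.fair (p := p) (G := fun j => e.EmptiesR j p d) (f := fun _ => 0)
    (fun k hk => Or.inr ⟨d, .R2, hen k hk⟩) (fun k hk hn => ?_) 0 i ⟨hi, hx, hrel, hE⟩ le_rfl
  obtain ⟨h0, h1, h2, h3⟩ := hk
  refine ⟨⟨by omega, (bufR_succ h1 hn).1, released_succ h1 h2,
    bufE_none_keep h3 fun h => hn (Or.inl h)⟩, le_rfl, fun hc => ?_⟩
  obtain ⟨r, hr⟩ := hst.exists_rule h0 hc (hen k ⟨h0, h1, h2, h3⟩)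
  cases r with
  | R1 => simpa [h1] using (e.guard_of_rule hr).2.1
  | R2 => exact absurd (Or.inl hr) hn
  | R3 => simpa [h1] using (e.guard_of_rule hr).1
  | R4 =>
    obtain ⟨y, hy, -⟩ := e.guard_of_rule hr
    simp [h3] at hy
  | R5 => exact absurd (Or.inr hr) hn
  | R6 => exact absurd h3 (e.guard_of_rule hr).2

/-- A message in a reception buffer is released within five rounds, or erased. -/
theorem Stable.released (hst : e.Stable i₀) (hi : i₀ ≤ i) {x : Msg V M G.maxDegree}
    (hx : (e.conf i).bufR p d = some x)
    (hno : ∀ j, i ≤ j → j < e.roundEnd i 5 → ¬ e.EmptiesR j p d) :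
    ∃ j, i ≤ j ∧ j ≤ e.roundEnd i 5 ∧ Released (e.conf j) p d x := by
  by_cases hrel : Released (e.conf i) p d x
  · exact ⟨i, le_rfl, le_roundEnd e.fair i 5, hrel⟩
  · rw [Released, not_or, not_not] at hrel
    obtain ⟨hl, y, hy, hxy⟩ := hrel
    have hadj : G.Adj p x.last := ((e.wellTyped i).1 p d x hx).resolve_left hl
    have hle : e.roundEnd i 2 ≤ e.roundEnd i 5 := roundEnd_mono_right e.fair i (by omega)
    suffices h : ∃ j, i ≤ j ∧ j < e.roundEnd i 5 ∧ e.EmptiesE j x.last d by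
      obtain ⟨j, hj, hj', h⟩ := h
      refine ⟨j + 1, by omega, hj', Or.inr ?_⟩
      rintro ⟨z, hz, -⟩
      simp [h.bufE_eq] at hz
    -- If `p` is the next hop of the source, the source empties its buffer within five rounds.
    -- Otherwise `x` is a duplicate, and since `hno` excludes its erasure, the source must be
    -- emptied first.
    by_cases hh : hop A (e.conf i₀) x.last d = p
    · have hld : x.last ≠ d := by
        rintro rfl
        exact hl ((A.nextHop_self _ _).symm.trans hh)
      refine hst.emptiesE_of_copied hi hld hy ?_
      rw [hh, hx, hxy.1, hxy.2]
    · obtain ⟨j, hj, hj', h | h⟩ := hst.duplicate hi hx hl hy hxy hh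
      · exact absurd h (hno j hj (by omega))
      · exact ⟨j, hj, by omega, h⟩

/-- If `bufE_p(d)` is emptied within `K` rounds whenever it is full, then `bufR_p(d)` is emptied
within `K + 6` rounds. -/
theorem Stable.emptiesR (hst : e.Stable i₀) {K : ℕ}
    (hK : ∀ i, i₀ ≤ i → (e.conf i).bufE p d ≠ none →
      ∃ j, i ≤ j ∧ j < e.roundEnd i K ∧ e.EmptiesE j p d)
    (hi : i₀ ≤ i) (hR : (e.conf i).bufR p d ≠ none) :
    ∃ j, i ≤ j ∧ j < e.roundEnd i (K + 6) ∧ e.EmptiesR j p d := by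
  by_contra! hno
  obtain ⟨x, hx⟩ := Option.ne_none_iff_exists'.1 hR
  have hle : e.roundEnd i 5 ≤ e.roundEnd i (K + 6) := roundEnd_mono_right e.fair i (by omega)
  obtain ⟨j, hj, hj', hrel⟩ := hst.released hi hx fun j h1 h2 => hno j h1 (by omega)
  have hkeep : ∀ k, i ≤ k → k ≤ e.roundEnd i (K + 6) → (e.conf k).bufR p d = some x :=
    fun k h1 h2 => persists (P := fun k => (e.conf k).bufR p d = some x)
      (G := fun k => e.EmptiesR k p d) (fun m hm hn => (bufR_succ hm hn).1)
      (fun m h3 h4 => hno m h3 (by omega)) hx h1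
  -- Five rounds for the release, `K` for the emission buffer to become empty, one for `R2`.
  have hle' : e.roundEnd j (K + 1) ≤ e.roundEnd i (K + 6) := by
    rw [show K + 6 = 5 + (K + 1) by omega]
    exact roundEnd_trans e.fair hj'
  have hkeep' : ∀ k, j ≤ k → k ≤ e.roundEnd i (K + 6) →
      (e.conf k).bufR p d = some x ∧ Released (e.conf k) p d x := fun k h1 h2 =>
    persists (P := fun k => (e.conf k).bufR p d = some x ∧ Released (e.conf k) p d x)
      (G := fun k => e.EmptiesR k p d)
      (fun m hm hn => ⟨(bufR_succ hm.1 hn).1, released_succ hm.1 hm.2⟩)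
      (fun m h3 h4 => hno m (by omega) (by omega)) ⟨hkeep j hj (by omega), hrel⟩ h1
  have hfin : ∀ l, j ≤ l → l ≤ e.roundEnd j K → (e.conf l).bufE p d = none → False := by
    intro l hl hl' hE
    have h1 : e.roundEnd l 1 ≤ e.roundEnd j (K + 1) := roundEnd_trans e.fair hl'
    have h2 : l ≤ e.roundEnd l 1 := le_roundEnd e.fair l 1
    obtain ⟨h3, h4⟩ := hkeep' l hl (by omega)
    obtain ⟨m, hm, hm', h⟩ := hst.emptiesR_of_released (by omega) h3 h4 hE
    exact hno m (by omega) (by omega) h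
  by_cases hE : (e.conf j).bufE p d = none
  · exact hfin j le_rfl (le_roundEnd e.fair j K) hE
  · obtain ⟨l, hl, hl', h⟩ := hK j (by omega) hE
    exact hfin (l + 1) (by omega) hl' h.bufE_eq

end Execution

end Liveness

/-- A bound on the number of rounds in which an emission buffer at distance `δ` from the
destination is emptied, once the routing tables are correct. -/
def emissionBound (Δ : ℕ) : ℕ → ℕ
  | 0 => 3
  | δ + 1 => (if δ = 0 then Δ + 1 else Δ) * (emissionBound Δ δ + 8) + 5

/-- A bound on the number of rounds in which a message at distance `δ` from the destination is
delivered, once the routing tables are correct. -/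
def deliveryBound (Δ : ℕ) : ℕ → ℕ
  | 0 => 2 * emissionBound Δ 0 + 6
  | δ + 1 => 2 * emissionBound Δ (δ + 1) + 6 + deliveryBound Δ δ

/-- A slack c passes through the recurrence with factor Δ if 5 + c ≤ Δ(c - 8), which for Δ = 2 means
c ≥ 21. The factor 30 covers distance one, where the claim reads 11Δ + 37 ≤ 30Δ. -/
theorem emissionBound_le {Δ : ℕ} (hΔ : 2 ≤ Δ) (δ : ℕ) :
    emissionBound Δ δ + 21 ≤ 30 * Δ ^ δ := by
  induction δ with
  | zero => simp [emissionBound]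
  | succ δ ih =>
    rcases δ with _ | δ
    · simp only [emissionBound, if_true, zero_add, pow_one]
      omega
    · rw [emissionBound, if_neg (by omega), pow_succ]
      nlinarith

/-- For Δ ≥ 2, the two emission waits contribute at most 60 Δ^(δ+1), with slack that absorbs the 6,
and the remaining path at most 120 Δ^δ ≤ 60 Δ^(δ+1). For Δ ≤ 1 only δ ≤ 1 is possible. -/
theorem deliveryBound_le {Δ δ : ℕ} (h1 : 1 ≤ δ → 1 ≤ Δ) (h2 : 2 ≤ δ → 2 ≤ Δ) :
    deliveryBound Δ δ ≤ 120 * Δ ^ δ := by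
  rcases lt_or_ge Δ 2 with hΔ | hΔ
  · have hδ : δ ≤ 1 := by omega
    interval_cases δ
    · simp [deliveryBound, emissionBound]
    · obtain rfl : Δ = 1 := by omega
      decide
  · clear h1 h2
    induction δ with
    | zero => simp [deliveryBound, emissionBound]
    | succ δ ih =>
      have h := emissionBound_le hΔ (δ + 1)
      have : 2 * Δ ^ δ ≤ Δ ^ (δ + 1) := by
        rw [pow_succ, mul_comm]
        exact Nat.mul_le_mul_left _ hΔ
      rw [deliveryBound]
      omega

theorem one_le_maxDegree {V : Type u} [Fintype V] {G : SimpleGraph V} [DecidableRel G.Adj]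
    (hG : G.Connected) {q d : V} (h : 1 ≤ G.dist q d) : 1 ≤ G.maxDegree := by
  have : Nontrivial V := ⟨q, d, by rintro rfl; simp at h⟩
  exact (hG.preconnected.degree_pos_of_nontrivial q).trans_le (G.degree_le_maxDegree q)

/-! ### Fair service by the queues and progress towards the destination -/

section Delivery

variable {V : Type u} [Fintype V] [DecidableEq V] {G : SimpleGraph V} [DecidableRel G.Adj]
  {M : Type v} {σ : Type w} {A : RoutingAlgorithm G σ}

namespace Execution

variable {e : Execution A M} {i₀ i k t : ℕ} {p q n d : V}

/-- With correct tables, the next hop of `n` never forwards to `n`. -/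
theorem Stable.hop_hop_ne (hst : e.Stable i₀) (hnd : n ≠ d) :
    hop A (e.conf i₀) (hop A (e.conf i₀) n d) d ≠ n := by
  intro h
  have h1 := hst.dist_hop hnd
  by_cases hd : hop A (e.conf i₀) n d = d
  · rw [hd, hop, A.nextHop_self] at h
    exact hnd h.symm
  · have h2 := hst.dist_hop hd
    rw [h] at h2
    omega

/-- The processors that may be served by `n` for destination `d`. -/
def MayServe (e : Execution A M) (i₀ : ℕ) (n d s : V) : Prop :=
  n = d ∨ s ≠ hop A (e.conf i₀) n d

instance (e : Execution A M) (i₀ : ℕ) (n d : V) : DecidablePred (e.MayServe i₀ n d) :=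
  fun s => inferInstanceAs (Decidable (n = d ∨ s ≠ hop A (e.conf i₀) n d))

/-- For `n ≠ d`, the next hop of `n` does not forward to `n` and differs from `n`, so it is never a
candidate there. -/
theorem Stable.mayServe_of_choice (hst : e.Stable i₀) (hk : i₀ ≤ k) {s : V}
    (h : choice A (e.conf k) n d = some s) : e.MayServe i₀ n d s := by
  by_cases hnd : n = d
  · exact Or.inl hnd
  refine Or.inr ?_
  rintro rfl
  rcases choice_candidate h with ⟨-, -, h1⟩ | ⟨h1, -⟩
  · rw [hst.hop_eq hk] at h1
    exact hst.hop_hop_ne hnd h1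
  · exact (A.nextHop_adj n _ d hnd).ne h1.symm

/-- The number of processors before `p` in the queue of its next hop that may be served. -/
theorem Stable.countP_le (hst : e.Stable i₀) (hadj : G.Adj n p)
    (hh : hop A (e.conf i₀) p d = n) {a b : List V} (hq : (e.conf k).queue n d = a ++ p :: b) :
    a.countP (fun s => decide (e.MayServe i₀ n d s)) + 1 ≤
      if n = d then G.maxDegree + 1 else G.maxDegree := by
  obtain ⟨hnd, hmem⟩ := (e.wellTyped k).2.2 n d
  rw [hq] at hnd hmem
  have hdeg := G.degree_le_maxDegree n
  rw [← SimpleGraph.card_neighborFinset_eq_degree] at hdeg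
  have hcard : (insert n (G.neighborFinset n)).card ≤ G.maxDegree + 1 :=
    (Finset.card_insert_le _ _).trans (by omega)
  have hpa : p ∉ a := fun h => (List.disjoint_of_nodup_append hnd) h List.mem_cons_self
  have ha : a.Nodup := hnd.of_append_left
  have hsub : ∀ s ∈ a, s ∈ insert n (G.neighborFinset n) := fun s hs => by
    simpa using (hmem s).1 (List.mem_append_left _ hs)
  have hp : p ∈ insert n (G.neighborFinset n) := by simp [hadj]
  rw [List.countP_eq_length_filter]
  set F := a.filter (fun s => decide (e.MayServe i₀ n d s)) with hF
  have hFa : ∀ s ∈ F, s ∈ a ∧ e.MayServe i₀ n d s := fun s hs => by simpa [hF] using hs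
  have hFn : F.Nodup := ha.filter _
  have hbound : ∀ l : List V, l.Nodup → (∀ s ∈ l, s ∈ insert n (G.neighborFinset n)) →
      l.length ≤ G.maxDegree + 1 := fun l hl hs => by
    rw [← List.toFinset_card_of_nodup hl]
    exact (Finset.card_le_card fun s h => hs s (by simpa using h)).trans hcard
  have hpF : p ∉ F := fun h => hpa (hFa p h).1
  split_ifs with h
  · have := hbound (p :: F) (List.nodup_cons.2 ⟨hpF, hFn⟩) (by
      simp only [List.mem_cons, forall_eq_or_imp]
      exact ⟨hp, fun s hs => hsub s (hFa s hs).1⟩)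
    simpa using this
  · have hne : hop A (e.conf i₀) n d ≠ p := by
      intro h'
      exact hst.hop_hop_ne h (by rw [h', hh])
    have hF' : hop A (e.conf i₀) n d ∉ F := fun h' => by
      rcases (hFa _ h').2 with h'' | h''
      · exact h h''
      · exact h'' rfl
    -- Away from the destination, the next hop of `n`, `p` and the members of `F` are distinct among
    -- at most Δ + 1 processors; the excluded next hop saves one turn.
    have := hbound (hop A (e.conf i₀) n d :: p :: F)
      (List.nodup_cons.2 ⟨by simp [hne, hF'], List.nodup_cons.2 ⟨hpF, hFn⟩⟩) (by
      simp only [List.mem_cons, forall_eq_or_imp]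
      refine ⟨?_, hp, fun s hs => hsub s (hFa s hs).1⟩
      have : G.Adj n (hop A (e.conf i₀) n d) := A.nextHop_adj _ _ _ h
      simp [this])
    simpa using this

theorem FillsR.choice_queue (h : e.FillsR k n d) : ∃ s, choice A (e.conf k) n d = some s ∧
    (e.conf (k + 1)).queue n d = ((e.conf k).queue n d).erase s ++ [s] := by
  rcases h with h | h
  · obtain ⟨m, -, -, h1⟩ := e.effect_R1 h
    exact ⟨n, (e.guard_of_rule h).2.2, h1⟩
  · obtain ⟨s, x, hs, -, -, -, -, -, h1⟩ := e.effect_R3 h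
    exact ⟨s, hs, h1⟩

/-- If `bufR_n(d)` is emptied within `K` rounds whenever it is full, then the emission buffer of a
processor `p` with next hop `n` is emptied after `n` has served those before `p` in its queue. -/
theorem Stable.emptiesE_of_queue (hst : e.Stable i₀) (hadj : G.Adj n p)
    (hh : hop A (e.conf i₀) p d = n) {K : ℕ}
    (hK : ∀ i, i₀ ≤ i → (e.conf i).bufR n d ≠ none →
      ∃ j, i ≤ j ∧ j < e.roundEnd i K ∧ e.EmptiesR j n d) (c : ℕ) :
    ∀ i (a b : List V), i₀ ≤ i → (e.conf i).bufE p d ≠ none →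
      (e.conf i).queue n d = a ++ p :: b →
      a.countP (fun s => decide (e.MayServe i₀ n d s)) ≤ c →
      ∃ j, i ≤ j ∧ j < e.roundEnd i ((c + 1) * (K + 2) + 5) ∧ e.EmptiesE j p d := by
  have hpd : p ≠ d := by
    rintro rfl
    exact hadj.ne (hh.symm.trans (A.nextHop_self _ _))
  induction c with
  | zero => ?_
  | succ c ih => ?_
  -- Both cases analyse one turn of `n`: its reception buffer becomes empty, then is filled from
  -- some `s`. If `s = p`, the copy leads to the emptying of `p` within five rounds. Otherwise `s`
  -- stands before `p` and may be served, which contradicts a count of zero; in the inductive case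
  -- `s` moves behind `p` and the count drops.
  all_goals
    intro i a b hi hE hq hc
    by_contra! hno
    obtain ⟨y, hy⟩ := Option.ne_none_iff_exists'.1 hE
    have hkeep : ∀ k, i ≤ k → k ≤ e.roundEnd i (K + 2) → (e.conf k).bufE p d = some y := by
      intro k h1 h2
      refine persists (P := fun k => (e.conf k).bufE p d = some y)
        (G := fun k => e.EmptiesE k p d) (fun m hm hn => bufE_succ hm hn)
        (fun m h3 h4 => hno m h3 ?_) hy h1
      refine (h4.trans_le h2).trans_le (roundEnd_mono_right e.fair i ?_)
      nlinarith
    obtain ⟨i₁, hi₁, hi₁', hR, hq₁⟩ : ∃ i₁, i ≤ i₁ ∧ i₁ ≤ e.roundEnd i K ∧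
        (e.conf i₁).bufR n d = none ∧ (e.conf i₁).queue n d = a ++ p :: b := by
      by_cases hR : (e.conf i).bufR n d = none
      · exact ⟨i, le_rfl, le_roundEnd e.fair i K, hR, hq⟩
      · obtain ⟨x, hx⟩ := Option.ne_none_iff_exists'.1 hR
        -- Taking the first emptying, and below the first filling, guarantees that the queue has not
        -- changed in between.
        obtain ⟨j, hj, hj', h, hfirst⟩ := exists_first (hK i hi hR)
        obtain ⟨hxj, hqj⟩ := persists (P := fun k => (e.conf k).bufR n d = some x ∧
            (e.conf k).queue n d = a ++ p :: b) (G := fun k => e.EmptiesR k n d)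
          (fun m hm hn => ⟨(bufR_succ hm.1 hn).1, (bufR_succ hm.1 hn).2.trans hm.2⟩)
          hfirst ⟨hx, hq⟩ hj
        refine ⟨j + 1, by omega, hj', h.bufR_eq, ?_⟩
        rw [← hqj]
        rcases h with h | h
        · obtain ⟨x, c, -, -, -, -, h1⟩ := e.effect_R2 h
          exact h1
        · exact (e.effect_R5 h).2.2
    have hle : e.roundEnd i₁ 2 ≤ e.roundEnd i (K + 2) := roundEnd_trans e.fair hi₁'
    have hle' : i₁ ≤ e.roundEnd i₁ 2 := le_roundEnd e.fair i₁ 2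
    obtain ⟨j, hj, hj', h⟩ :
        ∃ j, i₁ ≤ j ∧ j < e.roundEnd i₁ 2 ∧ e.FillsR j n d := by
      obtain ⟨j, hj, hj', h | h⟩ := hst.fillsR (by omega) hadj hh (hkeep i₁ hi₁ (by omega)) hR
      · exact ⟨j, hj, hj', h⟩
      · refine absurd h (hno j (by omega) ((hj'.trans_le hle).trans_le
          (roundEnd_mono_right e.fair i ?_)))
        nlinarith
    obtain ⟨j, hj, hj', h, hfirst⟩ := exists_first (P := fun j => e.FillsR j n d) ⟨j, hj, hj', h⟩
    obtain ⟨hRj, hqj⟩ := persists (P := fun k => (e.conf k).bufR n d = none ∧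
        (e.conf k).queue n d = a ++ p :: b) (G := fun k => e.FillsR k n d)
      (fun m hm hn => (bufR_none_keep hm.1 (fun h => hn (Or.inl h)) (fun h => hn (Or.inr h))).imp_right
        fun h => h.trans hm.2) hfirst ⟨hR, hq₁⟩ hj
    have hyj := hkeep j (by omega) (by omega)
    obtain ⟨s, hs, hq'⟩ := h.choice_queue
    have hserve := hst.mayServe_of_choice (by omega) hs
    have hserved : s ≠ p := by
      rintro rfl
      rcases h with h | h
      · have := (e.guard_of_rule h).2.2
        rw [hs] at this
        cases this
        exact hadj.ne rfl
      · obtain ⟨s', x, hs', -, -, hx, hRx, -⟩ := e.effect_R3 h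
        rw [hs] at hs'
        cases hs'
        rw [hyj] at hx
        cases hx
        obtain ⟨l, hl, hl', h⟩ := hst.emptiesE_of_copied (i := j + 1) (by omega) hpd
          (hkeep (j + 1) (by omega) (by omega)) (by rw [hh]; exact hRx)
        refine hno l (by omega) (hl'.trans_le ?_) h
        refine (roundEnd_trans e.fair (show j + 1 ≤ e.roundEnd i (K + 2) by omega)).trans
          (roundEnd_mono_right e.fair i ?_)
        nlinarith
    -- `p` is itself a candidate, so the first candidate in the queue cannot come after it.
    have hsa : s ∈ a := by
      have hcand : Candidate A (e.conf j) n d p :=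
        Or.inl ⟨hadj, by simp [hyj], by rwa [hst.hop_eq (by omega)]⟩
      rw [choice, hqj, List.find?_append, List.find?_cons_of_pos (by simpa using hcand)] at hs
      rcases Option.or_eq_some_iff.1 hs with hf | ⟨-, hf⟩
      · exact List.mem_of_find?_eq_some hf
      · exact absurd (Option.some.inj hf).symm hserved
    have hpos : 0 < a.countP (fun s => decide (e.MayServe i₀ n d s)) :=
      List.countP_pos_iff.2 ⟨s, hsa, by simpa using hserve⟩
  · omega
  · rw [hqj, List.erase_append_left _ hsa, List.append_assoc, List.cons_append] at hq'
    obtain ⟨l, hl, hl', h⟩ := ih (j + 1) _ _ (by omega)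
      (by rw [hkeep (j + 1) (by omega) (by omega)]; simp) hq' (by
        have hce : (a.erase s).countP (fun s => decide (e.MayServe i₀ n d s)) =
            a.countP (fun s => decide (e.MayServe i₀ n d s)) - 1 := by
          simp [List.countP_erase, hsa, hserve]
        omega)
    refine hno l (by omega) (hl'.trans_le ?_) h
    refine (roundEnd_trans e.fair (show j + 1 ≤ e.roundEnd i (K + 2) by omega)).trans
      (roundEnd_mono_right e.fair i ?_)
    nlinarith

/-- Induction along the next hops: the bound at distance δ costs 6 more rounds for the reception
buffer there and 2 more for each refill, whence the 8 in `emissionBound`; `Stable.countP_le` bounds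
the number of turns. -/
theorem Stable.emptiesE (hst : e.Stable i₀) (hG : G.Connected) (δ : ℕ) : ∀ p i, i₀ ≤ i →
    G.dist p d = δ → (e.conf i).bufE p d ≠ none →
    ∃ j, i ≤ j ∧ j < e.roundEnd i (emissionBound G.maxDegree δ) ∧ e.EmptiesE j p d := by
  induction δ with
  | zero =>
    intro p i hi hδ hE
    obtain rfl : p = d := hG.dist_eq_zero_iff.1 hδ
    exact hst.emptiesE_of_guard (Q := fun k => i₀ ≤ k ∧ (e.conf k).bufE p p ≠ none)
      (fun k hk => ⟨hk.1, Or.inr ⟨rfl, hk.2⟩⟩)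
      (fun k hk hn => by
        obtain ⟨y, hy⟩ := Option.ne_none_iff_exists'.1 hk.2
        exact ⟨by omega, by simp [bufE_succ hy hn]⟩) ⟨hi, hE⟩
  | succ δ ih =>
    intro p i hi hδ hE
    have hpd : p ≠ d := by
      rintro rfl
      simp at hδ
    have hadj : G.Adj (hop A (e.conf i₀) p d) p := (A.nextHop_adj _ _ _ hpd).symm
    have hdist : G.dist (hop A (e.conf i₀) p d) d = δ := by
      have := hst.dist_hop hpd
      omega
    have hmem := (((e.wellTyped i).2.2 (hop A (e.conf i₀) p d) d).2 p).2 (Or.inr hadj)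
    obtain ⟨a, b, hq⟩ := List.append_of_mem hmem
    have hc := hst.countP_le hadj rfl hq
    have hiff : hop A (e.conf i₀) p d = d ↔ δ = 0 := by
      rw [← hdist, hG.dist_eq_zero_iff]
    simp only [hiff] at hc
    obtain ⟨j, hj, hj', h⟩ := hst.emptiesE_of_queue hadj rfl
      (fun i hi hR => hst.emptiesR (fun i hi => ih _ i hi hdist) hi hR) _ i a b hi hE hq le_rfl
    refine ⟨j, hj, hj'.trans_le (roundEnd_mono_right e.fair i ?_), h⟩
    rw [emissionBound]
    exact Nat.add_le_add_right (Nat.mul_le_mul_right _ hc) 5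

/-- A message in an emission buffer is delivered, or moves one hop towards its destination. -/
theorem Stable.forward_of_inEmission (hst : e.Stable i₀) (hG : G.Connected) (hi : i₀ ≤ i)
    (hq : e.InEmission t p d i q) :
    ∃ j, i ≤ j ∧ j < e.roundEnd i (emissionBound G.maxDegree (G.dist q d)) ∧
      ((q = d ∧ e.Delivers t p d j) ∨
        (q ≠ d ∧ e.InReception t p d (j + 1) (hop A (e.conf i₀) q d))) := by
  obtain ⟨-, y, hy, -⟩ := id hq
  -- Up to the first emptying the buffer holds the message followed, so this emptying is its own.
  obtain ⟨j, hj, hj', h, hfirst⟩ := exists_first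
    (hst.emptiesE (d := d) hG _ q i hi rfl (by simp [hy]))
  have hqj : e.InEmission t p d j q := persists
    (P := fun k => e.InEmission t p d k q) (G := fun k => e.EmptiesE k q d)
    (fun m hm hn => hm.keep (fun h => hn (Or.inl h)) (fun h => hn (Or.inr h))) hfirst hq hj
  refine ⟨j, hj, hj', ?_⟩
  rcases h with h | h
  · have := hqj.forward h
    rw [hst.hop_eq (by omega)] at this
    exact Or.inr this
  · obtain rfl : q = d := (e.guard_of_rule h).1
    exact Or.inl ⟨rfl, hqj.1, h⟩

/-- A message in a reception buffer moves to the emission buffer. -/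
theorem Stable.forward_of_inReception (hst : e.Stable i₀) (hG : G.Connected) (hi : i₀ ≤ i)
    (hq : e.InReception t p d i q) :
    ∃ j, i ≤ j ∧ j < e.roundEnd i (emissionBound G.maxDegree (G.dist q d) + 6) ∧
      e.InEmission t p d (j + 1) q := by
  obtain ⟨-, x, hx, -⟩ := id hq
  obtain ⟨j, hj, hj', h, hfirst⟩ := exists_first
    (hst.emptiesR (d := d) (fun i hi => hst.emptiesE hG _ q i hi rfl) hi (by simp [hx]))
  have hqj : e.InReception t p d j q := persists
    (P := fun k => e.InReception t p d k q) (G := fun k => e.EmptiesR k q d)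
    (fun m hm hn => hm.keep (fun h => hn (Or.inl h))) hfirst hq hj
  exact ⟨j, hj, hj', hqj.forward (h.resolve_right hqj.not_R5)⟩

/-- Each hop costs one wait to leave the reception buffer and one to leave the emission buffer, and
then the distance drops by one. -/
theorem Stable.delivers (hst : e.Stable i₀) (hG : G.Connected) (δ : ℕ) : ∀ q i, i₀ ≤ i →
    G.dist q d = δ → e.InReception t p d i q ∨ e.InEmission t p d i q →
    ∃ j, i ≤ j ∧ j < e.roundEnd i (deliveryBound G.maxDegree δ) ∧ e.Delivers t p d j := by
  have hRE : ∀ q i, i₀ ≤ i → e.InReception t p d i q ∨ e.InEmission t p d i q →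
      ∃ j, i ≤ j ∧ j < e.roundEnd i (2 * emissionBound G.maxDegree (G.dist q d) + 6) ∧
      ((q = d ∧ e.Delivers t p d j) ∨
        (q ≠ d ∧ e.InReception t p d (j + 1) (hop A (e.conf i₀) q d))) := by
    rintro q i hi (h | h)
    · obtain ⟨j, hj, hj', h⟩ := hst.forward_of_inReception hG hi h
      obtain ⟨l, hl, hl', h⟩ := hst.forward_of_inEmission hG (by omega) h
      refine ⟨l, by omega, (hl'.trans_le (roundEnd_trans e.fair hj')).trans_le
        (roundEnd_mono_right e.fair i (by omega)), h⟩
    · obtain ⟨l, hl, hl', h⟩ := hst.forward_of_inEmission hG hi h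
      exact ⟨l, hl, hl'.trans_le (roundEnd_mono_right e.fair i (by omega)), h⟩
  induction δ with
  | zero =>
    intro q i hi hδ h
    obtain ⟨j, hj, hj', ⟨-, h⟩ | ⟨hqd, -⟩⟩ := hRE q i hi h
    · rw [hδ] at hj'
      exact ⟨j, hj, hj', h⟩
    · exact absurd (hG.dist_eq_zero_iff.1 hδ) hqd
  | succ δ ih =>
    intro q i hi hδ h
    obtain ⟨j, hj, hj', ⟨rfl, -⟩ | ⟨hqd, h⟩⟩ := hRE q i hi h
    · simp at hδ
    · have hdist := hst.dist_hop hqd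
      obtain ⟨l, hl, hl', h⟩ := ih _ (j + 1) (by omega) (by omega) (Or.inl h)
      rw [hδ] at hj'
      exact ⟨l, by omega, hl'.trans_le (roundEnd_trans e.fair hj'), h⟩

/-- The next hop of `q` is an inner vertex of a shortest path: `q` and its own next hop are two
distinct neighbours. -/
theorem Stable.two_le_maxDegree (hst : e.Stable i₀) (h : 2 ≤ G.dist q d) : 2 ≤ G.maxDegree := by
  have hqd : q ≠ d := by
    rintro rfl
    simp at h
  have hadj : G.Adj q (hop A (e.conf i₀) q d) := A.nextHop_adj _ _ _ hqd
  have hdist := hst.dist_hop hqd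
  set n := hop A (e.conf i₀) q d with hn
  have hnd : n ≠ d := by
    intro h'
    rw [h', SimpleGraph.dist_self] at hdist
    omega
  have hadj' : G.Adj n (hop A (e.conf i₀) n d) := A.nextHop_adj _ _ _ hnd
  have hne : q ≠ hop A (e.conf i₀) n d := fun h' => hst.hop_hop_ne hnd (by rw [← h'])
  refine le_trans ?_ (G.degree_le_maxDegree n)
  rw [← SimpleGraph.card_neighborFinset_eq_degree, ← Finset.card_pair hne]
  refine Finset.card_le_card fun s hs => ?_
  simp only [Finset.mem_insert, Finset.mem_singleton] at hs
  rcases hs with rfl | rfl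
  · simpa using hadj.symm
  · simpa using hadj'

theorem Stable.deliveryBound_le (hst : e.Stable i₀) (hG : G.Connected) (q d : V) :
    deliveryBound G.maxDegree (G.dist q d) ≤ 120 * G.maxDegree ^ G.diam := by
  have hne : Nonempty V := ⟨q⟩
  have hle : G.dist q d ≤ G.diam :=
    SimpleGraph.dist_le_diam (SimpleGraph.connected_iff_ediam_ne_top.1 hG)
  refine (SSMFP.deliveryBound_le (one_le_maxDegree hG) hst.two_le_maxDegree).trans
    (Nat.mul_le_mul_left _ ?_)
  -- Powers of 0 are not monotone in the exponent, but for maximal degree 0 the distance and the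
  -- diameter both vanish.
  rcases Nat.eq_zero_or_pos G.maxDegree with h0 | h0
  · obtain ⟨a, b, hab⟩ := G.exists_dist_eq_diam
    have h1 : G.diam = 0 := by
      by_contra h
      have := one_le_maxDegree hG (q := a) (d := b) (by omega)
      omega
    have h2 : G.dist q d = 0 := by omega
    rw [h1, h2]
  · exact Nat.pow_le_pow_right h0 hle

end Execution

end Delivery

end SSMFP

theorem mainTheorem3 :
    ∃ C : ℕ, ∀ (V : Type u) [Fintype V] [DecidableEq V] (G : SimpleGraph V) [DecidableRel G.Adj]
      (M : Type v) (σ : Type w) (A : SSMFP.RoutingAlgorithm G σ) (RA : ℕ)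
      (e : SSMFP.Execution A M) (t : ℕ) (p d : V),
      G.Connected → A.IsStabilizationTime RA → e.Generates t p d →
        ∃ t' : ℕ, t < t' ∧ t' < e.roundEnd (t + 1) (C * max RA (G.maxDegree ^ G.diam)) ∧
          e.Delivers t p d t' := by
  -- `RA` rounds of stabilization plus 120 Δ^D rounds of delivery are at most 121 times the maximum.
  refine ⟨121, ?_⟩
  intro V _ _ G _ M σ A RA e t p d hG hRA hgen
  obtain ⟨i₀, hi₀, hi₀', hst⟩ := SSMFP.Execution.exists_stable hRA.1 e (t + 1)
  have hmono : ∀ {K}, K ≤ RA + 120 * G.maxDegree ^ G.diam → e.roundEnd (t + 1) K ≤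
      e.roundEnd (t + 1) (121 * max RA (G.maxDegree ^ G.diam)) := fun hK =>
    SSMFP.roundEnd_mono_right e.fair _ (by omega)
  -- By the time the tables are stable the message is either already delivered or still in some
  -- buffer, from which it is followed to `d`.
  rcases SSMFP.Execution.exists_buffer_of_generates hgen hi₀ with ⟨t', h1, h2, h3⟩ | ⟨q, hq⟩
  · exact ⟨t', h1, (h2.trans_le hi₀').trans_le (hmono (by omega)), h3⟩
  · obtain ⟨j, hj, hj', h⟩ := hst.delivers hG _ q i₀ le_rfl rfl hq
    have := hst.deliveryBound_le hG q d
    exact ⟨j, by omega, (hj'.trans_le (SSMFP.roundEnd_trans e.fair hi₀')).trans_le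
      (hmono (by omega)), h⟩
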